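/- **Setting.** Fix $T>0$, $n>0$ and a probability space carrying a Brownian motion $B=(B_t)_{t\in[0,T]}$. Let $D$ be $\sigma(B_u:u\le T)$-measurable with $\mathbb E[D^2]<\infty$, and let $\sigma$ be the process, progressively measurable for the augmented Brownian filtration, with $\mathbb E\int_0^T\sigma_u^2du<\infty$ and $D=\mathbb E[D]+\int_0^T\sigma_u\,dB_u$ a.s. The targets $a_1,a_2$ are square-integrable random variables such that the pair $(a_1,a_2)$ is independent of $B$. Let $\kappa:(0,T)\to(0,\infty)$ be measurable with $\int_0^T\kappa(t)\,dt<\infty$, and let $\gamma:[0,T]\to[0,1]$ be càdlàg and nondecreasing. Put $a_\Sigma=a_1+a_2$ and $A_i=a_i-\frac12a_\Sigma$ for $i=1,2$. Stochastic integrals against $B$ are Itô integrals with respect to the augmented filtration generated by $(a_1,a_2)$ at time $0$ and by $B$. Given a price process $\hat S$, agent $i$ has the filtration $\mathcal F_{i,t}=\sigma(a_i,\hat S_u:0\le u\le t)$. The set $\mathcal A_i$ of admissible strategies consists of the $(\mathcal F_{i,t})$-adapted processes $\theta$ on $[0,T]$ whose paths are a.s. càdlàg and of finite variation and for which $\mathbb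 E\int_0^T(\sigma_t\theta_t)^2dt<\infty$. Write $\theta_t=\frac n2+\theta^\uparrow_t-\theta^\downarrow_t$ for the Jordan decomposition, where an initial trade $\theta_0-\frac n2$ is counted in $\theta^\uparrow_0-\theta^\downarrow_0$. For a transaction cost $\lambda>0$ and coefficients $c_0=c_0(t;a_\Sigma)$, $c_1,c_2\in\mathbb R$, agent $i$ holding $\theta$ perceives the price $$S^\theta_{i,t}=\hat S_0+\int_0^t\kappa(u)\Big(c_0(u;a_\Sigma)-c_1\theta_u+\gamma(u)c_2\big(a_i-\tfrac n2\big)\Big)du+\int_0^t\sigma_u\,dB_u,$$ and has the wealth $X^\theta_{i,t}=\frac n2\hat S_0+\int_0^t\theta_u\,dS^\theta_{i,u}-\lambda(\theta^\uparrow_t+\theta^\downarrow_t)$ and the penalty $$L^\theta_{i,T}=\frac12\int_0^T\kappa(t)\Big(\gamma(t)\big(a_i-\tfrac n2\big)-\big(\theta_t-\tfrac n2\big)\Big)^2dt.$$ A *price impact equilibrium* consists of $\theta_1\in\mathcal A_1$, $\theta_2\in\mathcal A_2$, $\hat S$, $c_0,c_1,c_2$ such that: (a) for $i=1,2$, the positive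 part of $X^\theta_{i,T}-L^\theta_{i,T}$ is integrable for every $\theta\in\mathcal A_i$, the variable $X^{\theta_i}_{i,T}-L^{\theta_i}_{i,T}$ is integrable, and $\mathbb E[X^{\theta_i}_{i,T}-L^{\theta_i}_{i,T}\mid\mathcal F_{i,0}]=\sup_{\theta\in\mathcal A_i}\mathbb E[X^{\theta}_{i,T}-L^{\theta}_{i,T}\mid\mathcal F_{i,0}]$ (an essential supremum of conditional expectations with values in $[-\infty,\infty)$); (b) almost surely, $\theta_{1,t}+\theta_{2,t}=n$ for all $t\in[0,T]$; (c) $\hat S$ is an Itô process with martingale part $\int_0^\cdot\sigma\,dB$, $\hat S_T=D$ a.s., and almost surely $S^{\theta_1}_{1,t}=S^{\theta_2}_{2,t}=\hat S_t$ for all $t$ in the support of the measure $d\theta_1^\uparrow+d\theta_1^\downarrow$ on $[0,T]$. **Theorem.** Let $\lambda>0$ and $c_1>-\frac12$. Define $$\tau=\inf\Big\{t\in[0,T]:|A_1|\tfrac{1+2c_1}{1+c_1}\int_t^T\kappa(u)(\gamma(u)-\gamma(t))\,du\le\lambda\Big\},\qquad \chi=|A_1|\tfrac{1+2c_1}{1+c_1}\int_0^T\kappa(u)\gamma(u)\,du,$$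 $$c_0(t)=c_1n-\frac{1+2c_1}{2(1+c_1)}\gamma(t)(a_\Sigma-n),\qquad c_2=\frac{c_1}{1+c_1},$$ $$\theta_{i,t}=\begin{cases}\frac n2+\frac{A_i}{1+c_1}\gamma(t), & t<\tau,\\[2pt] \frac n2+\frac1{\int_\tau^T\kappa(u)du}\Big\{\int_\tau^T\kappa(u)\gamma(u)\frac{A_i}{1+c_1}du-\frac{\lambda\,\mathrm{sgn}(A_i)}{1+2c_1}\Big\}, & t\ge\tau,\ \chi>\lambda,\\[2pt] \frac n2, & t\ge\tau,\ \chi\le\lambda,\end{cases}$$ with $\mathrm{sgn}(0)=0$, and $$\hat S_t=\mathbb E[D]+\int_0^t\sigma_u\,dB_u+\frac12\int_t^T\kappa(u)\big(\gamma(u)(a_\Sigma-n)-c_1n\big)du,$$ where $\int_0^\cdot\sigma\,dB$ is a version with continuous paths, all started at $0$. Then $\hat S,\theta_1,\theta_2,c_0,c_1,c_2$ form a price impact equilibrium. If moreover $\gamma(t)>0$ for some $t\in[0,T)$, then $\mathcal F_{1,t}=\mathcal F_{2,t}$ for all $t\in[0,T]$. -/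

import Mathlib

open Set Filter MeasureTheory ProbabilityTheory
open scoped Topology ENNReal

noncomputable section

namespace PriceImpact

variable {Ω : Type*}

/-! ### Information and stochastic integration on a finite horizon

Processes are functions `ℝ → Ω → ℝ`; only their values at times in `[0, T]` matter. A family of
σ-algebras indexed by time is a function `ℝ → MeasurableSpace Ω`. -/

/-- The σ-algebra `σ(X_u : 0 ≤ u ≤ t)`. -/
abbrev history (X : ℝ → Ω → ℝ) (t : ℝ) : MeasurableSpace Ω :=
  ⨆ u ∈ Icc (0 : ℝ) t, MeasurableSpace.comap (X u) inferInstance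

/-- The σ-algebra generated by the measurable sets of measure zero. -/
abbrev nullSets [MeasurableSpace Ω] (μ : Measure Ω) : MeasurableSpace Ω :=
  MeasurableSpace.generateFrom {s | MeasurableSet s ∧ μ s = 0}

/-- `B` is a standard one-dimensional Brownian motion on the time interval `[0, T]`. -/
structure IsBrownianOn [MeasurableSpace Ω] (μ : Measure Ω) (T : ℝ) (B : ℝ → Ω → ℝ) : Prop where
  measurable : ∀ t ∈ Icc (0 : ℝ) T, Measurable (B t)
  zero : ∀ᵐ ω ∂μ, B 0 ω = 0
  continuous : ∀ᵐ ω ∂μ, ContinuousOn (fun t => B t ω) (Icc 0 T)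
  gaussian : ∀ s t : ℝ, 0 ≤ s → s ≤ t → t ≤ T →
    HasLaw (fun ω => B t ω - B s ω) (gaussianReal 0 (t - s).toNNReal) μ
  indep : ∀ s t : ℝ, 0 ≤ s → s ≤ t → t ≤ T →
    Indep (MeasurableSpace.comap (fun ω => B t ω - B s ω) inferInstance) (history B s) μ

/-- Progressive measurability on `[0, T]`: for each `t`, the restriction of `(u, ω) ↦ H_u(ω)` to
`[0, t] × Ω` is measurable for the product of the Borel σ-algebra and `𝔾 t`. -/
def ProgMeasurableOn (𝔾 : ℝ → MeasurableSpace Ω) (T : ℝ) (H : ℝ → Ω → ℝ) : Prop :=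
  ∀ t ∈ Icc (0 : ℝ) T,
    Measurable[(inferInstance : MeasurableSpace (Icc (0 : ℝ) t)).prod (𝔾 t)]
      (fun p : Icc (0 : ℝ) t × Ω => H p.1 p.2)

/-- `E ∫_0^T H_u² du`. -/
def energy [MeasurableSpace Ω] (μ : Measure Ω) (T : ℝ) (H : ℝ → Ω → ℝ) : ℝ≥0∞ :=
  ∫⁻ ω, (∫⁻ u in Icc (0 : ℝ) T, ‖H u ω‖ₑ ^ 2) ∂μ

/-- Simple predictable processes `∑_j ξ_j 1_{(t_j, t_{j+1}]}` with `ξ_j` bounded and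
`𝔾 t_j`-measurable. -/
structure SimpleIntegrand (𝔾 : ℝ → MeasurableSpace Ω) (T : ℝ) where
  num : ℕ
  time : ℕ → ℝ
  time_mono : Monotone time
  time_mem : ∀ j, time j ∈ Icc (0 : ℝ) T
  val : ℕ → Ω → ℝ
  val_meas : ∀ j, Measurable[𝔾 (time j)] (val j)
  val_bdd : ∀ j, ∃ C : ℝ, ∀ ω, |val j ω| ≤ C

/-- The process `∑_j ξ_j 1_{(t_j, t_{j+1}]}(t)`. -/
def SimpleIntegrand.eval {𝔾 : ℝ → MeasurableSpace Ω} {T : ℝ} (H : SimpleIntegrand 𝔾 T)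
    (t : ℝ) (ω : Ω) : ℝ :=
  ∑ j ∈ Finset.range H.num, (Ioc (H.time j) (H.time (j + 1))).indicator (fun _ => H.val j ω) t

/-- The integral `∑_j ξ_j (B_{t_{j+1} ∧ t} - B_{t_j ∧ t})` of a simple process. -/
def SimpleIntegrand.integral {𝔾 : ℝ → MeasurableSpace Ω} {T : ℝ} (H : SimpleIntegrand 𝔾 T)
    (B : ℝ → Ω → ℝ) (t : ℝ) (ω : Ω) : ℝ :=
  ∑ j ∈ Finset.range H.num,
    H.val j ω * (B (min (H.time (j + 1)) t) ω - B (min (H.time j) t) ω)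

/-- `I` is a continuous version, started at `0`, of the Itô integral process `∫_0^· H dB`:
the integrals of simple processes approximating `H` in `L²(dt ⊗ μ)` converge to `I_t` in `L²(μ)`
at every time `t ∈ [0, T]`. -/
structure IsItoIntegral [MeasurableSpace Ω] (μ : Measure Ω) (𝔾 : ℝ → MeasurableSpace Ω) (T : ℝ)
    (B H I : ℝ → Ω → ℝ) : Prop where
  zero : ∀ ω, I 0 ω = 0
  continuous : ∀ ω, ContinuousOn (fun t => I t ω) (Icc 0 T)
  adapted : ∀ t ∈ Icc (0 : ℝ) T, Measurable[𝔾 t] (I t)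
  approx : ∃ Φ : ℕ → SimpleIntegrand 𝔾 T,
    Tendsto (fun k => energy μ T (fun t ω => (Φ k).eval t ω - H t ω)) atTop (𝓝 0) ∧
    ∀ t ∈ Icc (0 : ℝ) T,
      Tendsto (fun k => ∫⁻ ω, ‖(Φ k).integral B t ω - I t ω‖ₑ ^ 2 ∂μ) atTop (𝓝 0)

open scoped Classical in
/-- The Itô integral process `∫_0^· H dB` (unique up to indistinguishability). -/
def itoIntegral [MeasurableSpace Ω] (μ : Measure Ω) (𝔾 : ℝ → MeasurableSpace Ω) (T : ℝ)
    (B H : ℝ → Ω → ℝ) : ℝ → Ω → ℝ :=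
  if h : ∃ I, IsItoIntegral μ 𝔾 T B H I then h.choose else 0

/-- `S` is an Itô process on `[0, T]` with diffusion coefficient `v` satisfying
`E ∫_0^T v_u² du < ∞`: `S_t = S_0 + ∫_0^t b_u du + ∫_0^t v_u dB_u`. -/
def IsIeval [MeasurableSpace Ω] (μ : Measure Ω) (𝔾 : ℝ → MeasurableSpace Ω) (T : ℝ)
    (B v S : ℝ → Ω → ℝ) : Prop :=
  Measurable[𝔾 0] (S 0) ∧ ProgMeasurableOn 𝔾 T v ∧ energy μ T v < ∞ ∧
  ∃ b : ℝ → Ω → ℝ, ProgMeasurableOn 𝔾 T b ∧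
    (∀ᵐ ω ∂μ, IntervalIntegrable (fun u => b u ω) volume 0 T) ∧
    ∀ᵐ ω ∂μ, ∀ t ∈ Icc (0 : ℝ) T,
      S t ω = S 0 ω + (∫ u in (0 : ℝ)..t, b u ω) + itoIntegral μ 𝔾 T B v t ω

/-! ### Paths -/

/-- Right-continuous with left limits on `[0, T]`. -/
def IsCadlagOn (T : ℝ) (f : ℝ → ℝ) : Prop :=
  (∀ t ∈ Ico (0 : ℝ) T, ContinuousWithinAt f (Ici t) t) ∧
  ∀ t ∈ Ioc (0 : ℝ) T, ∃ l : ℝ, Tendsto f (𝓝[<] t) (𝓝 l)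

/-- Total variation up to time `t` of a path that starts from the position `x` just before
time `0`, so that the initial jump `f 0 - x` counts. -/
def totalVar (x : ℝ) (f : ℝ → ℝ) (t : ℝ) : ℝ :=
  |f 0 - x| + (eVariationOn f (Icc 0 t)).toReal

/-- `f^↑`, the increasing part of the Jordan decomposition `f = x + f^↑ - f^↓`. -/
def upPart (x : ℝ) (f : ℝ → ℝ) (t : ℝ) : ℝ := (totalVar x f t + (f t - x)) / 2

/-- `f^↓`, the decreasing part of the Jordan decomposition `f = x + f^↑ - f^↓`. -/
def downPart (x : ℝ) (f : ℝ → ℝ) (t : ℝ) : ℝ := (totalVar x f t - (f t - x)) / 2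

/-- The distribution function on `ℝ` of the measure `df^↑ + df^↓` on `[0, T]`. -/
def tradedVolume (x T : ℝ) (f : ℝ → ℝ) (t : ℝ) : ℝ :=
  if t < 0 then 0 else upPart x f (min t T) + downPart x f (min t T)

/-- The times in `[0, T]` at which `df^↑ + df^↓ > 0`, i.e. the support of that measure. -/
def tradeTimes (x T : ℝ) (f : ℝ → ℝ) : Set ℝ :=
  {t ∈ Icc (0 : ℝ) T | ∀ ε > 0, tradedVolume x T f (t - ε) < tradedVolume x T f (t + ε)}

/-! ### Conditional expectation of possibly non-integrable variables -/

/-- `E[f | 𝓖] = E[f⁺ | 𝓖] - E[f⁻ | 𝓖]` with values in `[-∞, ∞]`; meaningful as soon as `f⁺` is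
integrable. -/
def condExpE [MeasurableSpace Ω] (μ : Measure Ω) (𝓖 : MeasurableSpace Ω) (f : Ω → ℝ) :
    Ω → EReal := fun ω =>
  ((condLExp 𝓖 μ (fun ω => ENNReal.ofReal (f ω)) ω : ℝ≥0∞) : EReal) -
    ((condLExp 𝓖 μ (fun ω => ENNReal.ofReal (-f ω)) ω : ℝ≥0∞) : EReal)

/-- `V` is the (essential) supremum of the family `𝓥` of random variables. -/
def IsEssSup [MeasurableSpace Ω] (μ : Measure Ω) (𝓥 : Set (Ω → EReal)) (V : Ω → EReal) : Prop :=
  (∀ W ∈ 𝓥, W ≤ᵐ[μ] V) ∧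
  ∀ U : Ω → EReal, Measurable U → (∀ W ∈ 𝓥, W ≤ᵐ[μ] U) → V ≤ᵐ[μ] U

/-! ### The market -/

/-- The primitives: horizon `T`, stock supply `n`, penalty intensity `κ`, target trajectory `γ`,
Brownian motion `B`, dividend `D` and its integrand `σ`, and the targets `a 0`, `a 1` of the two
agents. -/
structure Market (Ω : Type*) where
  T : ℝ
  n : ℝ
  κ : ℝ → ℝ
  γ : ℝ → ℝ
  B : ℝ → Ω → ℝ
  D : Ω → ℝ
  σ : ℝ → Ω → ℝ
  a : Fin 2 → Ω → ℝ

namespace Market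

/-- The Brownian filtration augmented by null sets. -/
abbrev brownianFiltration [MeasurableSpace Ω] (m : Market Ω) (μ : Measure Ω) (t : ℝ) :
    MeasurableSpace Ω :=
  history m.B t ⊔ nullSets μ

/-- `σ(a_1, a_2)`. -/
abbrev targets (m : Market Ω) : MeasurableSpace Ω :=
  MeasurableSpace.comap (m.a 0) inferInstance ⊔ MeasurableSpace.comap (m.a 1) inferInstance

/-- The Brownian filtration enlarged at time `0` by both targets; stochastic integrals are taken
with respect to this filtration, for which `B` remains a Brownian motion. -/
abbrev fullFiltration [MeasurableSpace Ω] (m : Market Ω) (μ : Measure Ω) (t : ℝ) :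
    MeasurableSpace Ω :=
  m.targets ⊔ m.brownianFiltration μ t

/-- `∫_0^· H dB`. -/
def stochInt [MeasurableSpace Ω] (m : Market Ω) (μ : Measure Ω) (H : ℝ → Ω → ℝ) : ℝ → Ω → ℝ :=
  itoIntegral μ (m.fullFiltration μ) m.T m.B H

/-- The standing assumptions on the primitives. -/
structure Standing [MeasurableSpace Ω] (m : Market Ω) (μ : Measure Ω) : Prop where
  T_pos : 0 < m.T
  n_pos : 0 < m.n
  κ_pos : ∀ t ∈ Ioo 0 m.T, 0 < m.κ t
  κ_meas : Measurable (fun t : Ioo 0 m.T => m.κ t)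
  κ_int : IntegrableOn m.κ (Ioo 0 m.T)
  γ_mem : ∀ t ∈ Icc 0 m.T, m.γ t ∈ Icc (0 : ℝ) 1
  γ_mono : MonotoneOn m.γ (Icc 0 m.T)
  γ_cadlag : IsCadlagOn m.T m.γ
  brownian : IsBrownianOn μ m.T m.B
  D_meas : Measurable[history m.B m.T] m.D
  D_sq : MemLp m.D 2 μ
  σ_prog : ProgMeasurableOn (m.brownianFiltration μ) m.T m.σ
  σ_sq : energy μ m.T m.σ < ∞
  D_eq : ∀ᵐ ω ∂μ, m.D ω = (∫ ω', m.D ω' ∂μ) + m.stochInt μ m.σ m.T ω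
  a_meas : ∀ i, Measurable (m.a i)
  a_sq : ∀ i, MemLp (m.a i) 2 μ
  indep : Indep m.targets (history m.B m.T) μ

/-- `a_Σ = a_1 + a_2`. -/
def aSum (m : Market Ω) (ω : Ω) : ℝ := m.a 0 ω + m.a 1 ω

/-- `A_i = a_i - a_Σ / 2`. -/
def A (m : Market Ω) (i : Fin 2) (ω : Ω) : ℝ := m.a i ω - m.aSum ω / 2

/-- Agent `i`'s filtration `σ(a_i, S_u : u ∈ [0, t])` when the stock price is `S`. -/
abbrev info (m : Market Ω) (S : ℝ → Ω → ℝ) (i : Fin 2) (t : ℝ) : MeasurableSpace Ω :=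
  MeasurableSpace.comap (m.a i) inferInstance ⊔ history S t

/-- Admissible strategies of agent `i` when the stock price is `S`. -/
structure Admissible [MeasurableSpace Ω] (m : Market Ω) (μ : Measure Ω) (S : ℝ → Ω → ℝ)
    (i : Fin 2) (θ : ℝ → Ω → ℝ) : Prop where
  adapted : ∀ t ∈ Icc 0 m.T, Measurable[m.info S i t] (θ t)
  cadlag : ∀ᵐ ω ∂μ, IsCadlagOn m.T (fun t => θ t ω)
  finiteVar : ∀ᵐ ω ∂μ, BoundedVariationOn (fun t => θ t ω) (Icc 0 m.T)
  sq_int : energy μ m.T (fun t ω => m.σ t ω * θ t ω) < ∞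

/-- The penalty `L_{i,T}^θ`. -/
def loss (m : Market Ω) (i : Fin 2) (θ : ℝ → Ω → ℝ) (ω : Ω) : ℝ :=
  1 / 2 * ∫ t in (0 : ℝ)..m.T,
    m.κ t * (m.γ t * (m.a i ω - m.n / 2) - (θ t ω - m.n / 2)) ^ 2

/-- Drift of the price that agent `i` perceives when she holds `θ`; the coefficient `c0` is a
function of time and of the value of `a_Σ`. -/
def perceivedDrift (m : Market Ω) (c0 : ℝ → ℝ → ℝ) (c1 c2 : ℝ) (i : Fin 2) (θ : ℝ → Ω → ℝ)
    (t : ℝ) (ω : Ω) : ℝ :=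
  m.κ t * (c0 t (m.aSum ω) - c1 * θ t ω + m.γ t * c2 * (m.a i ω - m.n / 2))

/-- The perceived price `S_i^θ`. Its initial value and its martingale part `∫ σ dB`, which do not
depend on `i` and `θ`, are those of the market price `S`. -/
def perceivedPrice [MeasurableSpace Ω] (m : Market Ω) (μ : Measure Ω) (S : ℝ → Ω → ℝ)
    (c0 : ℝ → ℝ → ℝ) (c1 c2 : ℝ) (i : Fin 2) (θ : ℝ → Ω → ℝ) (t : ℝ) (ω : Ω) : ℝ :=
  S 0 ω + (∫ u in (0 : ℝ)..t, m.perceivedDrift c0 c1 c2 i θ u ω) + m.stochInt μ m.σ t ω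

/-- The perceived wealth
`X_{i,t}^θ = (n/2) S_0 + ∫_0^t θ dS_i^θ - lam (θ^↑_t + θ^↓_t)`. -/
def wealth [MeasurableSpace Ω] (m : Market Ω) (μ : Measure Ω) (lam : ℝ) (S : ℝ → Ω → ℝ)
    (c0 : ℝ → ℝ → ℝ) (c1 c2 : ℝ) (i : Fin 2) (θ : ℝ → Ω → ℝ) (t : ℝ) (ω : Ω) : ℝ :=
  m.n / 2 * S 0 ω
    + ((∫ u in (0 : ℝ)..t, θ u ω * m.perceivedDrift c0 c1 c2 i θ u ω)
      + m.stochInt μ (fun u ω => θ u ω * m.σ u ω) t ω)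
    - lam * (upPart (m.n / 2) (fun u => θ u ω) t + downPart (m.n / 2) (fun u => θ u ω) t)

/-- The terminal payoff `X_{i,T}^θ - L_{i,T}^θ`. -/
def payoff [MeasurableSpace Ω] (m : Market Ω) (μ : Measure Ω) (lam : ℝ) (S : ℝ → Ω → ℝ)
    (c0 : ℝ → ℝ → ℝ) (c1 c2 : ℝ) (i : Fin 2) (θ : ℝ → Ω → ℝ) (ω : Ω) : ℝ :=
  m.wealth μ lam S c0 c1 c2 i θ m.T ω - m.loss i θ ω

/-- The objective `E[X_{i,T}^θ - L_{i,T}^θ | F_{i,0}]`. -/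
def objective [MeasurableSpace Ω] (m : Market Ω) (μ : Measure Ω) (lam : ℝ) (S : ℝ → Ω → ℝ)
    (c0 : ℝ → ℝ → ℝ) (c1 c2 : ℝ) (i : Fin 2) (θ : ℝ → Ω → ℝ) : Ω → EReal :=
  condExpE μ (m.info S i 0) (m.payoff μ lam S c0 c1 c2 i θ)

/-- Price impact equilibrium for the transaction cost `lam`: holdings `θ 0`, `θ 1`, stock price
`S` and price impact coefficients `c0`, `c1`, `c2`. -/
structure IsPriceImpactEquilibrium [MeasurableSpace Ω] (m : Market Ω) (μ : Measure Ω) (lam : ℝ)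
    (θ : Fin 2 → ℝ → Ω → ℝ) (S : ℝ → Ω → ℝ) (c0 : ℝ → ℝ → ℝ) (c1 c2 : ℝ) : Prop where
  admissible : ∀ i, m.Admissible μ S i (θ i)
  /-- The conditional expectation of the payoff is well defined for all admissible strategies. -/
  wellDefined : ∀ i η, m.Admissible μ S i η →
    ∫⁻ ω, ENNReal.ofReal (m.payoff μ lam S c0 c1 c2 i η ω) ∂μ < ∞
  integrable : ∀ i, Integrable (m.payoff μ lam S c0 c1 c2 i (θ i)) μ
  optimal : ∀ i, IsEssSup μ {W | ∃ η, m.Admissible μ S i η ∧ W = m.objective μ lam S c0 c1 c2 i η}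
    (m.objective μ lam S c0 c1 c2 i (θ i))
  clearing : ∀ᵐ ω ∂μ, ∀ t ∈ Icc 0 m.T, θ 0 t ω + θ 1 t ω = m.n
  ito : IsIeval μ (m.fullFiltration μ) m.T m.B m.σ S
  terminal : ∀ᵐ ω ∂μ, S m.T ω = m.D ω
  consistent : ∀ᵐ ω ∂μ, ∀ t ∈ tradeTimes (m.n / 2) m.T (fun u => θ 0 u ω),
    m.perceivedPrice μ S c0 c1 c2 0 (θ 0) t ω = S t ω ∧
    m.perceivedPrice μ S c0 c1 c2 1 (θ 1) t ω = S t ω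

/-! ### The explicit candidate -/

/-- The last trading time `τ`. -/
def lastTradingTime (m : Market Ω) (lam c1 : ℝ) (ω : Ω) : ℝ :=
  sInf {t ∈ Icc 0 m.T |
    |m.A 0 ω| * ((1 + 2 * c1) / (1 + c1)) * (∫ u in t..m.T, m.κ u * (m.γ u - m.γ t)) ≤ lam}

/-- The random variable `χ`. -/
def chi (m : Market Ω) (c1 : ℝ) (ω : Ω) : ℝ :=
  |m.A 0 ω| * (1 + 2 * c1) / (1 + c1) * ∫ u in (0 : ℝ)..m.T, m.κ u * m.γ u

/-- `c_0(t; a) = c_1 n - (1 + 2 c_1) / (2 (1 + c_1)) γ(t) (a - n)`. -/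
def coeff0 (m : Market Ω) (c1 : ℝ) (t a : ℝ) : ℝ :=
  c1 * m.n - (1 + 2 * c1) / (2 * (1 + c1)) * m.γ t * (a - m.n)

/-- `c_2 = c_1 / (1 + c_1)`. -/
def coeff2 (c1 : ℝ) : ℝ := c1 / (1 + c1)

open scoped Classical in
/-- The equilibrium holdings `θ_i`. -/
def holdings (m : Market Ω) (lam c1 : ℝ) (i : Fin 2) (t : ℝ) (ω : Ω) : ℝ :=
  let τ := m.lastTradingTime lam c1 ω
  if t < τ then m.n / 2 + m.A i ω / (1 + c1) * m.γ t
  else if lam < m.chi c1 ω then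
    m.n / 2 + 1 / (∫ u in τ..m.T, m.κ u) *
      ((∫ u in τ..m.T, m.κ u * m.γ u * (m.A i ω / (1 + c1)))
        - lam * Real.sign (m.A i ω) / (1 + 2 * c1))
  else m.n / 2

/-- The equilibrium stock price `Ŝ`. -/
def price [MeasurableSpace Ω] (m : Market Ω) (μ : Measure Ω) (c1 : ℝ) (t : ℝ) (ω : Ω) : ℝ :=
  (∫ ω', m.D ω' ∂μ) + m.stochInt μ m.σ t ω
    + 1 / 2 * ∫ u in t..m.T, m.κ u * (m.γ u * (m.aSum ω - m.n) - c1 * m.n)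

end Market

end PriceImpact

end

open PriceImpact

/-! Inserting the impact coefficients and completing the square in the holding (`payoff_eq`) turns
the payoff of agent `i` into a term independent of the strategy, plus a stochastic integral, minus
`(1 + 2 * c1) / 2` times the `κ`-weighted squared distance of `η - n / 2` from `A i / (1 + c1) * γ`,
minus `lam` times the total variation. The stochastic integral has conditional mean zero given the
time-0 information (`condExp_itoIntegral`), so it suffices to solve a deterministic problem path by
path: with `ℓ = lam / (1 + 2 * c1)` and `z = |A i| / (1 + c1)`, minimise quadratic penalty plus `2 *
ℓ` times variation around the target `± z γ`.

The solution follows `z γ` up to the exit time and is constant afterwards. Call `z γ` minus the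
position the shortfall. It is nonnegative, its `κ`-integral is at most `ℓ`, and by complementary
slackness its `κ`-integral against the position equals `ℓ` times the plateau. These three facts are
the first-order conditions; since a competitor never moves further from `n / 2` than its variation,
convexity gives global optimality (`position_optimal`). Monotonicity of the solution makes its
variation equal to the plateau.

The other requirements follow from the explicit form. The two agents have opposite `A i`, hence the
same exit time and opposite trades, so the market clears. The coefficients make perceived and market
drift agree while the target is tracked, and no trade happens after the exit time
(`holdings_consistent`). The initial price is affine in `aSum` with slope `1 / 2 * ∫ κ γ`: if this
is nonzero, each agent recovers both targets at time 0 (`info_eq`); if it is zero, the holdings are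
constantly `n / 2`, so adaptedness holds in both cases. Independence of targets and Brownian motion
gives the energy bound and lets stochastic integrals be taken in the enlarged filtration. -/

noncomputable section

namespace PriceImpact

/-! ### Bounded measurable paths -/

/-- Bounded paths on `[0, T]` that are measurable up to Lebesgue-null sets. -/
structure IsBddMeasOn (T : ℝ) (f : ℝ → ℝ) : Prop where
  meas : AEStronglyMeasurable f (volume.restrict (Icc 0 T))
  bdd : ∃ C, ∀ t ∈ Icc 0 T, |f t| ≤ C

namespace IsBddMeasOn

variable {T : ℝ} {f g : ℝ → ℝ}

lemma const (T c : ℝ) : IsBddMeasOn T (fun _ => c) :=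
  ⟨aestronglyMeasurable_const, |c|, fun _ _ => le_rfl⟩

lemma add (hf : IsBddMeasOn T f) (hg : IsBddMeasOn T g) : IsBddMeasOn T (fun t => f t + g t) := by
  obtain ⟨C, hC⟩ := hf.bdd
  obtain ⟨K, hK⟩ := hg.bdd
  exact ⟨hf.meas.add hg.meas, C + K, fun t ht =>
    (abs_add_le _ _).trans (add_le_add (hC t ht) (hK t ht))⟩

lemma mul (hf : IsBddMeasOn T f) (hg : IsBddMeasOn T g) : IsBddMeasOn T (fun t => f t * g t) := by
  obtain ⟨C, hC⟩ := hf.bdd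
  obtain ⟨K, hK⟩ := hg.bdd
  refine ⟨hf.meas.mul hg.meas, C * K, fun t ht => ?_⟩
  rw [abs_mul]
  exact mul_le_mul (hC t ht) (hK t ht) (abs_nonneg _) ((abs_nonneg _).trans (hC t ht))

lemma const_mul (c : ℝ) (hf : IsBddMeasOn T f) : IsBddMeasOn T (fun t => c * f t) :=
  (const T c).mul hf

lemma sub (hf : IsBddMeasOn T f) (hg : IsBddMeasOn T g) : IsBddMeasOn T (fun t => f t - g t) := by
  simpa [sub_eq_add_neg] using hf.add (hg.const_mul (-1))

lemma sq (hf : IsBddMeasOn T f) : IsBddMeasOn T (fun t => f t ^ 2) := by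
  simpa [pow_two] using hf.mul hf

lemma of_monotoneOn (hf : MonotoneOn f (Icc 0 T)) : IsBddMeasOn T f := by
  refine ⟨(aemeasurable_restrict_of_monotoneOn measurableSet_Icc hf).aestronglyMeasurable,
    |f 0| + |f T|, fun t ht => abs_le.2 ?_⟩
  have h0 := hf ⟨le_rfl, ht.1.trans ht.2⟩ ht ht.1
  have h1 := hf ht ⟨ht.1.trans ht.2, le_rfl⟩ ht.2
  constructor <;>
    linarith [neg_abs_le (f 0), le_abs_self (f T), abs_nonneg (f 0), abs_nonneg (f T)]

lemma of_boundedVariationOn (hf : BoundedVariationOn f (Icc 0 T)) : IsBddMeasOn T f := by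
  obtain ⟨p, q, hp, hq, rfl⟩ := hf.locallyBoundedVariationOn.exists_monotoneOn_sub_monotoneOn
  exact (of_monotoneOn hp).sub (of_monotoneOn hq)

end IsBddMeasOn

/-! ### The deterministic trading problem -/

/-- The standing assumptions on the penalty intensity and on the target trajectory. -/
structure IsPenalty (T : ℝ) (κ γ : ℝ → ℝ) : Prop where
  T_pos : 0 < T
  κ_pos : ∀ t ∈ Ioo 0 T, 0 < κ t
  κ_int : IntegrableOn κ (Icc 0 T)
  γ_mem : ∀ t ∈ Icc 0 T, γ t ∈ Icc (0 : ℝ) 1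
  γ_mono : MonotoneOn γ (Icc 0 T)
  γ_cadlag : IsCadlagOn T γ

/-- The last trading time for the cost `ℓ` and the target `z γ`. -/
def exitTime (κ γ : ℝ → ℝ) (T ℓ z : ℝ) : ℝ :=
  sInf {t ∈ Icc 0 T | z * ∫ u in t..T, κ u * (γ u - γ t) ≤ ℓ}

/-- The position held after the last trading time. -/
def plateau (κ γ : ℝ → ℝ) (T ℓ z : ℝ) : ℝ :=
  open scoped Classical in
  if ℓ < z * ∫ u in (0 : ℝ)..T, κ u * γ u then
    (z * (∫ u in (exitTime κ γ T ℓ z)..T, κ u * γ u) - ℓ) / ∫ u in (exitTime κ γ T ℓ z)..T, κ u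
  else 0

/-- The optimal position for the cost `ℓ` and the target `z γ`. -/
def position (κ γ : ℝ → ℝ) (T ℓ z t : ℝ) : ℝ :=
  open scoped Classical in
  if t < exitTime κ γ T ℓ z then z * γ t else plateau κ γ T ℓ z

namespace IsPenalty

variable {T : ℝ} {κ γ : ℝ → ℝ} (hP : IsPenalty T κ γ)
include hP

lemma κ_nonneg {t : ℝ} (ht : t ∈ Ioo 0 T) : 0 ≤ κ t := (hP.κ_pos t ht).le

lemma γ_bdd : IsBddMeasOn T γ := .of_monotoneOn hP.γ_mono

lemma integrableOn {f : ℝ → ℝ} (hf : IsBddMeasOn T f) :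
    IntegrableOn (fun u => κ u * f u) (Icc 0 T) := by
  obtain ⟨C, hC⟩ := hf.bdd
  refine Integrable.mul_bdd (c := C) hP.κ_int hf.meas ?_
  filter_upwards [ae_restrict_mem measurableSet_Icc] with t ht using hC t ht

lemma intervalIntegrable {f : ℝ → ℝ} (hf : IsBddMeasOn T f) {a b : ℝ} (ha : a ∈ Icc 0 T)
    (hb : b ∈ Icc 0 T) : IntervalIntegrable (fun u => κ u * f u) volume a b :=
  ((hP.integrableOn hf).mono_set (uIcc_subset_Icc ha hb)).intervalIntegrable

lemma intervalIntegrable_κ {a b : ℝ} (ha : a ∈ Icc 0 T) (hb : b ∈ Icc 0 T) :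
    IntervalIntegrable κ volume a b :=
  (hP.κ_int.mono_set (uIcc_subset_Icc ha hb)).intervalIntegrable

lemma zero_mem : (0 : ℝ) ∈ Icc 0 T := ⟨le_rfl, hP.T_pos.le⟩

lemma T_mem : T ∈ Icc 0 T := ⟨hP.T_pos.le, le_rfl⟩

lemma integral_mono {f g : ℝ → ℝ} (hf : IsBddMeasOn T f) (hg : IsBddMeasOn T g) {a b : ℝ}
    (ha : a ∈ Icc 0 T) (hb : b ∈ Icc 0 T) (hab : a ≤ b) (h : ∀ u ∈ Ioo a b, f u ≤ g u) :
    ∫ u in a..b, κ u * f u ≤ ∫ u in a..b, κ u * g u :=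
  intervalIntegral.integral_mono_on_of_le_Ioo hab (hP.intervalIntegrable hf ha hb)
    (hP.intervalIntegrable hg ha hb) fun u hu => mul_le_mul_of_nonneg_left (h u hu)
      (hP.κ_nonneg ⟨ha.1.trans_lt hu.1, hu.2.trans_le hb.2⟩)

lemma integral_nonneg {f : ℝ → ℝ} (hf : IsBddMeasOn T f) {a b : ℝ}
    (ha : a ∈ Icc 0 T) (hb : b ∈ Icc 0 T) (hab : a ≤ b) (h : ∀ u ∈ Ioo a b, 0 ≤ f u) :
    0 ≤ ∫ u in a..b, κ u * f u := by
  simpa using hP.integral_mono (.const T 0) hf ha hb hab h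

lemma tail_antitoneOn {f : ℝ → ℝ} (hf : IsBddMeasOn T f) (h : ∀ u ∈ Ioo 0 T, 0 ≤ f u) :
    AntitoneOn (fun t => ∫ u in t..T, κ u * f u) (Icc 0 T) := by
  intro s hs t ht hst
  have h1 := intervalIntegral.integral_add_adjacent_intervals
    (hP.intervalIntegrable hf hs ht) (hP.intervalIntegrable hf ht hP.T_mem)
  have h2 := hP.integral_nonneg hf hs ht hst fun u hu =>
    h u ⟨hs.1.trans_lt hu.1, hu.2.trans_le ht.2⟩
  dsimp only
  linarith

lemma continuousOn_tail {f : ℝ → ℝ} (hf : IsBddMeasOn T f) :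
    ContinuousOn (fun t => ∫ u in t..T, κ u * f u) (Icc 0 T) := by
  have := intervalIntegral.continuousOn_primitive_interval_left (a := 0) (b := T) (μ := volume)
    (f := fun u => κ u * f u) (by rw [uIcc_of_le hP.T_pos.le]; exact hP.integrableOn hf)
  rwa [uIcc_of_le hP.T_pos.le] at this

lemma continuousOn_tail_κ : ContinuousOn (fun t => ∫ u in t..T, κ u) (Icc 0 T) := by
  simpa using hP.continuousOn_tail (.const T 1)

lemma tail_κ_pos {t : ℝ} (ht : t ∈ Ico 0 T) : 0 < ∫ u in t..T, κ u :=
  intervalIntegral.intervalIntegral_pos_of_pos_on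
    (hP.intervalIntegrable_κ ⟨ht.1, ht.2.le⟩ hP.T_mem)
    (fun u hu => hP.κ_pos u ⟨ht.1.trans_lt hu.1, hu.2⟩) ht.2

lemma integral_sub_const {f : ℝ → ℝ} (hf : IsBddMeasOn T f) (c : ℝ) {a b : ℝ}
    (ha : a ∈ Icc 0 T) (hb : b ∈ Icc 0 T) :
    ∫ u in a..b, κ u * (f u - c) = (∫ u in a..b, κ u * f u) - c * ∫ u in a..b, κ u := by
  simp only [mul_sub]
  rw [intervalIntegral.integral_sub (hP.intervalIntegrable hf ha hb)
    ((hP.intervalIntegrable_κ ha hb).mul_const c), intervalIntegral.integral_mul_const, mul_comm c]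

variable {ℓ z : ℝ}

omit hP in
lemma bddBelow_exitSet :
    BddBelow {t ∈ Icc 0 T | z * ∫ u in t..T, κ u * (γ u - γ t) ≤ ℓ} := ⟨0, fun _ h => h.1.1⟩

lemma T_mem_exitSet (hℓ : 0 < ℓ) :
    T ∈ {t ∈ Icc 0 T | z * ∫ u in t..T, κ u * (γ u - γ t) ≤ ℓ} :=
  ⟨hP.T_mem, by simpa using hℓ.le⟩

lemma exitTime_mem (hℓ : 0 < ℓ) : exitTime κ γ T ℓ z ∈ Icc 0 T :=
  ⟨le_csInf ⟨T, hP.T_mem_exitSet hℓ⟩ fun _ h => h.1.1,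
    csInf_le bddBelow_exitSet (hP.T_mem_exitSet hℓ)⟩

lemma lt_of_lt_exitTime (hℓ : 0 < ℓ) {t : ℝ} (h0 : 0 ≤ t) (ht : t < exitTime κ γ T ℓ z) :
    ℓ < z * ∫ u in t..T, κ u * (γ u - γ t) := by
  by_contra! h
  exact notMem_of_lt_csInf ht bddBelow_exitSet ⟨⟨h0, ht.le.trans (hP.exitTime_mem hℓ).2⟩, h⟩

/-- Moving the time to the right drops a nonnegative piece of the integral and subtracts a larger
value of `γ`. For `z ≥ 0` the exit set is therefore closed upwards in `[0, T]`. -/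
lemma delayGain_antitoneOn :
    AntitoneOn (fun t => ∫ u in t..T, κ u * (γ u - γ t)) (Icc 0 T) := by
  intro s hs t ht hst
  have h1 := intervalIntegral.integral_add_adjacent_intervals
    (hP.intervalIntegrable (hP.γ_bdd.sub (.const T (γ s))) hs ht)
    (hP.intervalIntegrable (hP.γ_bdd.sub (.const T (γ s))) ht hP.T_mem)
  have h2 := hP.integral_nonneg (hP.γ_bdd.sub (.const T (γ s))) hs ht hst fun u hu =>
    sub_nonneg.2 (hP.γ_mono hs ⟨hs.1.trans hu.1.le, hu.2.le.trans ht.2⟩ hu.1.le)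
  have h3 := hP.integral_mono (hP.γ_bdd.sub (.const T (γ t))) (hP.γ_bdd.sub (.const T (γ s)))
    ht hP.T_mem ht.2 fun u _ => sub_le_sub_left (hP.γ_mono hs ht hst) _
  dsimp only
  linarith

lemma delayGain_nonneg {t : ℝ} (ht : t ∈ Icc 0 T) : 0 ≤ ∫ u in t..T, κ u * (γ u - γ t) :=
  hP.integral_nonneg (hP.γ_bdd.sub (.const T (γ t))) ht hP.T_mem ht.2 fun _ hu =>
    sub_nonneg.2 (hP.γ_mono ht ⟨ht.1.trans hu.1.le, hu.2.le⟩ hu.1.le)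

/-- A larger `z` shrinks the exit set because the integral is nonnegative. All measurability in `z`
rests on this. -/
lemma exitTime_mono (hℓ : 0 < ℓ) {z' : ℝ} (hzz : z ≤ z') :
    exitTime κ γ T ℓ z ≤ exitTime κ γ T ℓ z' :=
  csInf_le_csInf bddBelow_exitSet ⟨T, hP.T_mem_exitSet hℓ⟩ fun _ ht =>
    ⟨ht.1, (mul_le_mul_of_nonneg_right hzz (hP.delayGain_nonneg ht.1)).trans ht.2⟩

/-- As `0 ≤ γ ≤ 1`, the gain is at most `z` times the tail of `κ`, which falls below `ℓ` near `T`.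
Strictness keeps the denominator of the plateau positive. -/
lemma exitTime_lt (hℓ : 0 < ℓ) (hz : 0 ≤ z) : exitTime κ γ T ℓ z < T := by
  have hc : Tendsto (fun t => z * ∫ u in t..T, κ u) (𝓝[Icc 0 T] T) (𝓝 0) := by
    simpa using (hP.continuousOn_tail_κ T hP.T_mem).tendsto.const_mul z
  have hle : (𝓝[Ioo 0 T] T) ≤ 𝓝[Icc 0 T] T := nhdsWithin_mono _ Ioo_subset_Icc_self
  have : (𝓝[Ioo 0 T] T).NeBot := right_nhdsWithin_Ioo_neBot hP.T_pos
  obtain ⟨t, h1, ht⟩ := (((hc.mono_left hle).eventually (gt_mem_nhds hℓ)).and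
    self_mem_nhdsWithin).exists
  refine (csInf_le bddBelow_exitSet ⟨Ioo_subset_Icc_self ht, ?_⟩).trans_lt ht.2
  refine le_trans (mul_le_mul_of_nonneg_left ?_ hz) h1.le
  have := hP.integral_mono (hP.γ_bdd.sub (.const T (γ t))) (.const T 1) (Ioo_subset_Icc_self ht)
    hP.T_mem ht.2.le fun u hu => by
      linarith [(hP.γ_mem u ⟨ht.1.le.trans hu.1.le, hu.2.le⟩).2,
        (hP.γ_mem t (Ioo_subset_Icc_self ht)).1]
  simpa using this

/-- The infimum is attained: times just after it satisfy the inequality by antitonicity, and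
right-continuity of `γ` passes it to the limit. -/
lemma delayGain_exitTime_le (hℓ : 0 < ℓ) (hz : 0 ≤ z) :
    z * ∫ u in (exitTime κ γ T ℓ z)..T, κ u * (γ u - γ (exitTime κ γ T ℓ z)) ≤ ℓ := by
  set τ := exitTime κ γ T ℓ z
  have hm : τ ∈ Icc 0 T := hP.exitTime_mem hℓ
  have hlt : τ < T := hP.exitTime_lt hℓ hz
  have hle : 𝓝[Ioo τ T] τ ≤ 𝓝[Icc 0 T] τ :=
    nhdsWithin_mono _ fun u hu => ⟨hm.1.trans hu.1.le, hu.2.le⟩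
  have : (𝓝[Ioo τ T] τ).NeBot := left_nhdsWithin_Ioo_neBot hlt
  have hγ : Tendsto γ (𝓝[Ioo τ T] τ) (𝓝 (γ τ)) :=
    (hP.γ_cadlag.1 τ ⟨hm.1, hlt⟩).mono_left (nhdsWithin_mono _ fun u hu => hu.1.le)
  have hlim := (((hP.continuousOn_tail hP.γ_bdd τ hm).tendsto.mono_left hle).sub
    (hγ.mul ((hP.continuousOn_tail_κ τ hm).tendsto.mono_left hle))).const_mul z
  rw [hP.integral_sub_const hP.γ_bdd _ hm hP.T_mem]
  refine le_of_tendsto hlim ?_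
  filter_upwards [self_mem_nhdsWithin] with t ht
  have htm : t ∈ Icc 0 T := ⟨hm.1.trans ht.1.le, ht.2.le⟩
  rw [← hP.integral_sub_const hP.γ_bdd _ htm hP.T_mem]
  obtain ⟨s, hs, hst⟩ := exists_lt_of_csInf_lt ⟨T, hP.T_mem_exitSet hℓ⟩ ht.1
  exact (mul_le_mul_of_nonneg_left (hP.delayGain_antitoneOn hs.1 htm hst.le) hz).trans hs.2

lemma exitTime_eq_zero (hℓ : 0 < ℓ) (hz : 0 ≤ z) (h : z * ∫ u in (0 : ℝ)..T, κ u * γ u ≤ ℓ) :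
    exitTime κ γ T ℓ z = 0 := by
  refine le_antisymm (csInf_le bddBelow_exitSet ⟨hP.zero_mem, ?_⟩) (hP.exitTime_mem hℓ).1
  refine (mul_le_mul_of_nonneg_left ?_ hz).trans h
  exact hP.integral_mono (hP.γ_bdd.sub (.const T (γ 0))) hP.γ_bdd hP.zero_mem hP.T_mem
    hP.T_pos.le fun u _ => by linarith [(hP.γ_mem 0 hP.zero_mem).1]

/-- After clearing the denominator this is the exit inequality at the exit time itself; it makes the
shortfall nonnegative. -/
lemma plateau_le_target (hℓ : 0 < ℓ) (hz : 0 ≤ z) :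
    plateau κ γ T ℓ z ≤ z * γ (exitTime κ γ T ℓ z) := by
  have hm : exitTime κ γ T ℓ z ∈ Icc 0 T := hP.exitTime_mem hℓ
  unfold plateau
  split_ifs with h
  · rw [div_le_iff₀ (hP.tail_κ_pos ⟨hm.1, hP.exitTime_lt hℓ hz⟩)]
    have := hP.delayGain_exitTime_le hℓ hz
    rw [hP.integral_sub_const hP.γ_bdd _ hm hP.T_mem] at this
    linarith
  · exact mul_nonneg hz (hP.γ_mem _ hm).1

/-- The exit inequality fails at every `s` before the exit time; let `s` increase to it. Freezing `γ
s` at the smaller `γ t` first means only the tails need be continuous, so `γ` may jump at the exit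
time. -/
lemma target_le_plateau (hℓ : 0 < ℓ) (hz : 0 ≤ z) {t : ℝ} (h0 : 0 ≤ t)
    (ht : t < exitTime κ γ T ℓ z) : z * γ t ≤ plateau κ γ T ℓ z := by
  have hm : exitTime κ γ T ℓ z ∈ Icc 0 T := hP.exitTime_mem hℓ
  unfold plateau
  split_ifs with h
  · rw [le_div_iff₀ (hP.tail_κ_pos ⟨hm.1, hP.exitTime_lt hℓ hz⟩)]
    set τ := exitTime κ γ T ℓ z
    have hle : 𝓝[Ioo t τ] τ ≤ 𝓝[Icc 0 T] τ :=
      nhdsWithin_mono _ fun u hu => ⟨h0.trans hu.1.le, hu.2.le.trans hm.2⟩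
    have : (𝓝[Ioo t τ] τ).NeBot := right_nhdsWithin_Ioo_neBot ht
    have hlim := (((hP.continuousOn_tail hP.γ_bdd τ hm).tendsto.mono_left hle).sub
      (((hP.continuousOn_tail_κ τ hm).tendsto.mono_left hle).const_mul (γ t))).const_mul z
    have := ge_of_tendsto (b := ℓ) hlim (by
      filter_upwards [self_mem_nhdsWithin] with s hs
      have hsm : s ∈ Icc 0 T := ⟨h0.trans hs.1.le, hs.2.le.trans hm.2⟩
      have h1 := hP.lt_of_lt_exitTime hℓ hsm.1 hs.2
      rw [hP.integral_sub_const hP.γ_bdd _ hsm hP.T_mem] at h1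
      have h2 := hP.γ_mono ⟨h0, hs.1.le.trans hsm.2⟩ hsm hs.1.le
      have h3 := hP.tail_κ_pos ⟨hsm.1, hs.2.trans_le hm.2⟩
      refine h1.le.trans (mul_le_mul_of_nonneg_left ?_ hz)
      linarith [mul_le_mul_of_nonneg_right h2 h3.le])
    linarith
  · rw [hP.exitTime_eq_zero hℓ hz (not_lt.1 h)] at ht
    exact absurd h0 (not_le.2 ht)

lemma plateau_nonneg (hℓ : 0 < ℓ) (hz : 0 ≤ z) : 0 ≤ plateau κ γ T ℓ z := by
  have hm : exitTime κ γ T ℓ z ∈ Icc 0 T := hP.exitTime_mem hℓ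
  rcases hm.1.eq_or_lt with h0 | h0
  · unfold plateau
    split_ifs with h
    · rw [← h0]
      exact div_nonneg (sub_nonneg.2 h.le) (hP.tail_κ_pos ⟨le_rfl, hP.T_pos⟩).le
    · exact le_rfl
  · exact (mul_nonneg hz (hP.γ_mem 0 hP.zero_mem).1).trans (hP.target_le_plateau hℓ hz le_rfl h0)

omit hP in
lemma position_of_lt {t : ℝ} (ht : t < exitTime κ γ T ℓ z) : position κ γ T ℓ z t = z * γ t :=
  if_pos ht

omit hP in
lemma position_of_ge {t : ℝ} (ht : exitTime κ γ T ℓ z ≤ t) :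
    position κ γ T ℓ z t = plateau κ γ T ℓ z := if_neg (not_lt.2 ht)

lemma position_T (hℓ : 0 < ℓ) : position κ γ T ℓ z T = plateau κ γ T ℓ z :=
  position_of_ge (hP.exitTime_mem hℓ).2

lemma position_le_target (hℓ : 0 < ℓ) (hz : 0 ≤ z) {t : ℝ} (ht : t ∈ Icc 0 T) :
    position κ γ T ℓ z t ≤ z * γ t := by
  rcases lt_or_ge t (exitTime κ γ T ℓ z) with h | h
  · rw [position_of_lt h]
  · rw [position_of_ge h]
    exact (hP.plateau_le_target hℓ hz).trans
      (mul_le_mul_of_nonneg_left (hP.γ_mono (hP.exitTime_mem hℓ) ht h) hz)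

lemma position_nonneg (hℓ : 0 < ℓ) (hz : 0 ≤ z) {t : ℝ} (ht : t ∈ Icc 0 T) :
    0 ≤ position κ γ T ℓ z t := by
  rcases lt_or_ge t (exitTime κ γ T ℓ z) with h | h
  · rw [position_of_lt h]
    exact mul_nonneg hz (hP.γ_mem t ht).1
  · rw [position_of_ge h]
    exact hP.plateau_nonneg hℓ hz

lemma position_le (hℓ : 0 < ℓ) (hz : 0 ≤ z) {t : ℝ} (ht : t ∈ Icc 0 T) :
    position κ γ T ℓ z t ≤ z :=
  (hP.position_le_target hℓ hz ht).trans (mul_le_of_le_one_right hz (hP.γ_mem t ht).2)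

lemma position_mono (hℓ : 0 < ℓ) (hz : 0 ≤ z) : MonotoneOn (position κ γ T ℓ z) (Icc 0 T) := by
  intro s hs t ht hst
  rcases lt_or_ge t (exitTime κ γ T ℓ z) with h | h
  · rw [position_of_lt h, position_of_lt (hst.trans_lt h)]
    exact mul_le_mul_of_nonneg_left (hP.γ_mono hs ht hst) hz
  · rw [position_of_ge h]
    rcases lt_or_ge s (exitTime κ γ T ℓ z) with h' | h'
    · rw [position_of_lt h']
      exact hP.target_le_plateau hℓ hz hs.1 h'
    · rw [position_of_ge h']

lemma position_bdd (hℓ : 0 < ℓ) (hz : 0 ≤ z) : IsBddMeasOn T (position κ γ T ℓ z) :=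
  .of_monotoneOn (hP.position_mono hℓ hz)

lemma position_cadlag : IsCadlagOn T (position κ γ T ℓ z) := by
  refine ⟨fun t ht => ?_, fun t ht => ?_⟩
  · rcases lt_or_ge t (exitTime κ γ T ℓ z) with h | h
    · refine ((hP.γ_cadlag.1 t ht).const_mul z).congr_of_eventuallyEq ?_ (position_of_lt h)
      filter_upwards [mem_nhdsWithin_of_mem_nhds (Iio_mem_nhds h)] with u hu
        using position_of_lt hu
    · refine (continuousWithinAt_const (b := plateau κ γ T ℓ z)).congr_of_eventuallyEq ?_
        (position_of_ge h)
      filter_upwards [self_mem_nhdsWithin] with u hu using position_of_ge (h.trans hu)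
  -- The exit time itself belongs to the first case: its left limit sees only times at which the
  -- target is followed.
  · rcases le_or_gt t (exitTime κ γ T ℓ z) with h | h
    · obtain ⟨l, hl⟩ := hP.γ_cadlag.2 t ht
      refine ⟨z * l, (hl.const_mul z).congr' ?_⟩
      filter_upwards [self_mem_nhdsWithin] with u hu
        using (position_of_lt (lt_of_lt_of_le hu h)).symm
    · refine ⟨plateau κ γ T ℓ z, tendsto_const_nhds.congr' ?_⟩
      filter_upwards [mem_nhdsWithin_of_mem_nhds (Ioi_mem_nhds h)] with u hu
        using (position_of_ge (le_of_lt hu)).symm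

/-- The shortfall vanishes before the exit time and the position is constant after it, so such
integrals depend on `z` only through `z`, the plateau and tail integrals. -/
lemma integral_shortfall_mul (hℓ : 0 < ℓ) (hz : 0 ≤ z) {f : ℝ → ℝ} (hf : IsBddMeasOn T f) :
    ∫ u in (0 : ℝ)..T, κ u * ((z * γ u - position κ γ T ℓ z u) * f u) =
      z * (∫ u in (exitTime κ γ T ℓ z)..T, κ u * (γ u * f u)) -
        plateau κ γ T ℓ z * ∫ u in (exitTime κ γ T ℓ z)..T, κ u * f u := by
  have hm : exitTime κ γ T ℓ z ∈ Icc 0 T := hP.exitTime_mem hℓ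
  have hb := ((hP.γ_bdd.const_mul z).sub (hP.position_bdd hℓ hz)).mul hf
  rw [← intervalIntegral.integral_add_adjacent_intervals
    (hP.intervalIntegrable hb hP.zero_mem hm) (hP.intervalIntegrable hb hm hP.T_mem)]
  have h1 : ∫ u in (0 : ℝ)..exitTime κ γ T ℓ z,
      κ u * ((z * γ u - position κ γ T ℓ z u) * f u) = 0 := by
    refine intervalIntegral.integral_zero_ae ?_
    -- The exit time is discarded as a null set, since the position already sits on the plateau
    -- there.
    filter_upwards [Measure.ae_ne volume (exitTime κ γ T ℓ z)] with u hne hu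
    rw [uIoc_of_le hm.1] at hu
    rw [position_of_lt (lt_of_le_of_ne hu.2 hne)]
    ring
  have h2 : ∫ u in (exitTime κ γ T ℓ z)..T, κ u * ((z * γ u - position κ γ T ℓ z u) * f u) =
      ∫ u in (exitTime κ γ T ℓ z)..T,
        (z * (κ u * (γ u * f u)) - plateau κ γ T ℓ z * (κ u * f u)) := by
    refine intervalIntegral.integral_congr fun u hu => ?_
    rw [uIcc_of_le hm.2] at hu
    rw [position_of_ge hu.1]
    ring
  rw [h1, h2, zero_add, intervalIntegral.integral_sub
    ((hP.intervalIntegrable (hP.γ_bdd.mul hf) hm hP.T_mem).const_mul z)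
    ((hP.intervalIntegrable hf hm hP.T_mem).const_mul _),
    intervalIntegral.integral_const_mul, intervalIntegral.integral_const_mul]

lemma integral_shortfall (hℓ : 0 < ℓ) (hz : 0 ≤ z) :
    ∫ u in (0 : ℝ)..T, κ u * (z * γ u - position κ γ T ℓ z u) =
      z * (∫ u in (exitTime κ γ T ℓ z)..T, κ u * γ u) -
        plateau κ γ T ℓ z * ∫ u in (exitTime κ γ T ℓ z)..T, κ u := by
  simpa using hP.integral_shortfall_mul hℓ hz (.const T 1)

/-- First-order condition: the plateau is chosen to give equality, and without trading the bound is
the no-trade condition itself. -/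
lemma integral_shortfall_le (hℓ : 0 < ℓ) (hz : 0 ≤ z) :
    ∫ u in (0 : ℝ)..T, κ u * (z * γ u - position κ γ T ℓ z u) ≤ ℓ := by
  rw [hP.integral_shortfall hℓ hz]
  have hm : exitTime κ γ T ℓ z ∈ Icc 0 T := hP.exitTime_mem hℓ
  have hpos := hP.tail_κ_pos ⟨hm.1, hP.exitTime_lt hℓ hz⟩
  unfold plateau
  split_ifs with h
  · rw [div_mul_cancel₀ _ hpos.ne']
    linarith
  · rw [hP.exitTime_eq_zero hℓ hz (not_lt.1 h)]
    linarith

/-- Complementary slackness: either the first-order condition is an equality or the plateau is zero.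
-/
lemma plateau_mul_integral_shortfall (hℓ : 0 < ℓ) (hz : 0 ≤ z) :
    plateau κ γ T ℓ z * ∫ u in (0 : ℝ)..T, κ u * (z * γ u - position κ γ T ℓ z u) =
      plateau κ γ T ℓ z * ℓ := by
  rw [hP.integral_shortfall hℓ hz]
  have hm : exitTime κ γ T ℓ z ∈ Icc 0 T := hP.exitTime_mem hℓ
  have hpos := hP.tail_κ_pos ⟨hm.1, hP.exitTime_lt hℓ hz⟩
  unfold plateau
  split_ifs with h
  · rw [div_mul_cancel₀ _ hpos.ne']
    ring
  · ring

lemma integral_shortfall_mul_position (hℓ : 0 < ℓ) (hz : 0 ≤ z) :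
    ∫ u in (0 : ℝ)..T, κ u * ((z * γ u - position κ γ T ℓ z u) * position κ γ T ℓ z u) =
      plateau κ γ T ℓ z * ℓ := by
  rw [← hP.plateau_mul_integral_shortfall hℓ hz, ← intervalIntegral.integral_const_mul]
  refine intervalIntegral.integral_congr fun u _ => ?_
  rcases lt_or_ge u (exitTime κ γ T ℓ z) with h | h
  · rw [position_of_lt h]
    ring
  · rw [position_of_ge h]
    ring

/-- The monotone trading strategy minimises the sum of the quadratic penalty and of the
transaction costs over all paths `e` whose absolute value is bounded by their variation `v`. -/
lemma position_optimal (hℓ : 0 < ℓ) (hz : 0 ≤ z) {s : ℝ} (hs : s ^ 2 = 1) {e : ℝ → ℝ} {v : ℝ}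
    (he : IsBddMeasOn T e) (hv : ∀ t ∈ Icc 0 T, |e t| ≤ v) :
    (∫ u in (0 : ℝ)..T, κ u * (s * position κ γ T ℓ z u - s * (z * γ u)) ^ 2) +
        2 * ℓ * plateau κ γ T ℓ z ≤
      (∫ u in (0 : ℝ)..T, κ u * (e u - s * (z * γ u)) ^ 2) + 2 * ℓ * v := by
  have hφ := hP.position_bdd hℓ hz
  have hh := (hP.γ_bdd.const_mul z).sub hφ
  have h1 := hP.intervalIntegrable ((hφ.const_mul s).sub ((hP.γ_bdd.const_mul z).const_mul s)).sq
    hP.zero_mem hP.T_mem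
  have h2 := hP.intervalIntegrable (hh.mul hφ) hP.zero_mem hP.T_mem
  have h3 := hP.intervalIntegrable hh hP.zero_mem hP.T_mem
  have h4 := hP.intervalIntegrable (he.sub ((hP.γ_bdd.const_mul z).const_mul s)).sq
    hP.zero_mem hP.T_mem
  have hs1 : |s| = 1 := by rw [← sq_eq_sq₀ (abs_nonneg s) zero_le_one, sq_abs, hs]; norm_num
  have key := intervalIntegral.integral_mono_on_of_le_Ioo hP.T_pos.le
    (h1.add ((h2.const_mul 2).sub (h3.const_mul (2 * v)))) h4 (fun u hu => by
      have hu' : u ∈ Icc 0 T := Ioo_subset_Icc_self hu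
      have hsh : 0 ≤ z * γ u - position κ γ T ℓ z u :=
        sub_nonneg.2 (hP.position_le_target hℓ hz hu')
      have hse : s * e u ≤ v := (le_abs_self _).trans (by
        rw [abs_mul, hs1, one_mul]; exact hv u hu')
      -- Expand the square around the candidate, drop `(e - s * position) ^ 2`, and bound `s * e` by
      -- `v`, which is allowed because the shortfall is nonnegative.
      have hmain : (s * position κ γ T ℓ z u - s * (z * γ u)) ^ 2 +
          (2 * ((z * γ u - position κ γ T ℓ z u) * position κ γ T ℓ z u) -
            2 * v * (z * γ u - position κ γ T ℓ z u)) ≤ (e u - s * (z * γ u)) ^ 2 := by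
        have h5 := mul_le_mul_of_nonneg_left hse hsh
        have h6 : (e u - s * (z * γ u)) ^ 2 - (s * position κ γ T ℓ z u - s * (z * γ u)) ^ 2 =
          (e u - s * position κ γ T ℓ z u) ^ 2 +
            2 * ((z * γ u - position κ γ T ℓ z u) * position κ γ T ℓ z u) * s ^ 2 -
              2 * ((z * γ u - position κ γ T ℓ z u) * (s * e u)) := by ring
        rw [hs] at h6
        nlinarith [sq_nonneg (e u - s * position κ γ T ℓ z u)]
      have := mul_le_mul_of_nonneg_left hmain (hP.κ_nonneg hu)
      linarith)
  rw [intervalIntegral.integral_add h1 ((h2.const_mul 2).sub (h3.const_mul (2 * v))),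
    intervalIntegral.integral_sub (h2.const_mul 2) (h3.const_mul (2 * v)),
    intervalIntegral.integral_const_mul, intervalIntegral.integral_const_mul,
    hP.integral_shortfall_mul_position hℓ hz] at key
  have hv0 : 0 ≤ v := (abs_nonneg _).trans (hv 0 hP.zero_mem)
  have := mul_le_mul_of_nonneg_left (hP.integral_shortfall_le hℓ hz)
    (mul_nonneg zero_le_two hv0)
  linarith

/-- The square is shortfall times target minus shortfall times position. In this form measurability
in `z` is visible without joint measurability of the position. -/
lemma integral_position_sub_sq (hℓ : 0 < ℓ) (hz : 0 ≤ z) {s : ℝ} (hs : s ^ 2 = 1) :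
    ∫ u in (0 : ℝ)..T, κ u * (s * position κ γ T ℓ z u - s * (z * γ u)) ^ 2 =
      z * (z * (∫ u in (exitTime κ γ T ℓ z)..T, κ u * (γ u * γ u)) -
        plateau κ γ T ℓ z * ∫ u in (exitTime κ γ T ℓ z)..T, κ u * γ u) -
      plateau κ γ T ℓ z * ℓ := by
  have hφ := hP.position_bdd hℓ hz
  have hh := (hP.γ_bdd.const_mul z).sub hφ
  rw [← hP.integral_shortfall_mul hℓ hz hP.γ_bdd, ← hP.integral_shortfall_mul_position hℓ hz,
    ← intervalIntegral.integral_const_mul, ← intervalIntegral.integral_sub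
      ((hP.intervalIntegrable (hh.mul hP.γ_bdd) hP.zero_mem hP.T_mem).const_mul z)
      (hP.intervalIntegrable (hh.mul hφ) hP.zero_mem hP.T_mem)]
  refine intervalIntegral.integral_congr fun u _ => ?_
  linear_combination (κ u * (position κ γ T ℓ z u - z * γ u) ^ 2) * hs

/-! ### Measurable dependence on the size of the target -/

lemma measurable_exitTime (hℓ : 0 < ℓ) : Measurable (exitTime κ γ T ℓ) :=
  Monotone.measurable fun _ _ h => hP.exitTime_mono hℓ h

lemma measurable_tail_exitTime (hℓ : 0 < ℓ) {f : ℝ → ℝ} (hf : IsBddMeasOn T f)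
    (h : ∀ u ∈ Ioo 0 T, 0 ≤ f u) :
    Measurable fun z => ∫ u in (exitTime κ γ T ℓ z)..T, κ u * f u :=
  Antitone.measurable fun _ _ hzz => hP.tail_antitoneOn hf h (hP.exitTime_mem hℓ)
    (hP.exitTime_mem hℓ) (hP.exitTime_mono hℓ hzz)

lemma measurable_plateau (hℓ : 0 < ℓ) : Measurable (plateau κ γ T ℓ) := by
  have h1 := hP.measurable_tail_exitTime hℓ hP.γ_bdd
    fun u hu => (hP.γ_mem u (Ioo_subset_Icc_self hu)).1
  have h2 : Measurable fun z => ∫ u in (exitTime κ γ T ℓ z)..T, κ u := by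
    simpa using hP.measurable_tail_exitTime hℓ (.const T 1) fun _ _ => zero_le_one
  exact Measurable.ite (measurableSet_lt measurable_const (measurable_id.mul_const _))
    (((measurable_id.mul h1).sub_const ℓ).div h2) measurable_const

lemma measurable_position (hℓ : 0 < ℓ) (t : ℝ) : Measurable fun z => position κ γ T ℓ z t :=
  Measurable.ite (measurableSet_lt measurable_const (hP.measurable_exitTime hℓ))
    (measurable_id.mul_const _) (hP.measurable_plateau hℓ)

end IsPenalty

/-! ### Total variation -/

lemma abs_sub_le_totalVar {x T : ℝ} {f : ℝ → ℝ} (hf : BoundedVariationOn f (Icc 0 T)) {t : ℝ}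
    (ht : t ∈ Icc 0 T) : |f t - x| ≤ totalVar x f T := by
  have h1 := hf.dist_le ht ⟨le_rfl, ht.1.trans ht.2⟩
  rw [Real.dist_eq] at h1
  calc |f t - x| = |(f 0 - x) + (f t - f 0)| := by ring_nf
    _ ≤ |f 0 - x| + |f t - f 0| := abs_add_le _ _
    _ ≤ totalVar x f T := by unfold totalVar; linarith

lemma eVariationOn_signed {x s : ℝ} (hs : s ^ 2 = 1) (φ : ℝ → ℝ) (S : Set ℝ) :
    eVariationOn (fun t => x + s * φ t) S = eVariationOn φ S := by
  have hs1 : |s| = 1 := by rw [← sq_eq_sq₀ (abs_nonneg s) zero_le_one, sq_abs, hs]; norm_num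
  have : ∀ a b, edist (x + s * φ a) (x + s * φ b) = edist (φ a) (φ b) := fun a b => by
    rw [edist_dist, edist_dist, Real.dist_eq, Real.dist_eq,
      show x + s * φ a - (x + s * φ b) = s * (φ a - φ b) by ring, abs_mul, hs1, one_mul]
  simp only [eVariationOn, this]

lemma eVariationOn_of_monotoneOn {T t : ℝ} {φ : ℝ → ℝ} (hφ : MonotoneOn φ (Icc 0 T))
    (ht : t ∈ Icc 0 T) : eVariationOn φ (Icc 0 t) = ENNReal.ofReal (φ t - φ 0) := by
  rw [← hφ.eVariationOn_eq ⟨le_rfl, ht.1.trans ht.2⟩ ht,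
    inter_eq_self_of_subset_right (Icc_subset_Icc_right ht.2)]

lemma boundedVariationOn_signed {x s T : ℝ} (hs : s ^ 2 = 1) {φ : ℝ → ℝ} (hT : 0 ≤ T)
    (hφ : MonotoneOn φ (Icc 0 T)) : BoundedVariationOn (fun t => x + s * φ t) (Icc 0 T) := by
  rw [BoundedVariationOn, eVariationOn_signed hs, eVariationOn_of_monotoneOn hφ ⟨hT, le_rfl⟩]
  exact ENNReal.ofReal_ne_top

/-- The initial jump `φ 0` and the increment `φ t - φ 0` telescope. -/
lemma totalVar_signed {x s T t : ℝ} (hs : s ^ 2 = 1) {φ : ℝ → ℝ} (hφ : MonotoneOn φ (Icc 0 T))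
    (h0 : 0 ≤ φ 0) (ht : t ∈ Icc 0 T) : totalVar x (fun t => x + s * φ t) t = φ t := by
  have hs1 : |s| = 1 := by rw [← sq_eq_sq₀ (abs_nonneg s) zero_le_one, sq_abs, hs]; norm_num
  rw [totalVar, eVariationOn_signed hs, eVariationOn_of_monotoneOn hφ ht, add_sub_cancel_left,
    abs_mul, hs1, one_mul, abs_of_nonneg h0, ENNReal.toReal_ofReal
      (sub_nonneg.2 (hφ ⟨le_rfl, ht.1.trans ht.2⟩ ht ht.1))]
  ring

lemma tradedVolume_eq_totalVar {x T t : ℝ} (f : ℝ → ℝ) (ht : 0 ≤ t) :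
    tradedVolume x T f t = totalVar x f (min t T) := by
  rw [tradedVolume, if_neg (not_lt.2 ht), upPart, downPart]
  ring

/-- A signed monotone path is not traded after a time from which it is constant. -/
lemma le_of_mem_tradeTimes {x s T τ : ℝ} (hs : s ^ 2 = 1) {φ : ℝ → ℝ}
    (hφ : MonotoneOn φ (Icc 0 T)) (h0 : 0 ≤ φ 0) (hτ : 0 ≤ τ) (hc : ∀ u ≥ τ, φ u = φ τ) {t : ℝ}
    (ht : t ∈ tradeTimes x T (fun t => x + s * φ t)) : t ≤ τ := by
  by_contra! h
  have hT : 0 ≤ T := ht.1.1.trans ht.1.2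
  have key : ∀ u, τ ≤ u → τ ≤ T → tradedVolume x T (fun t => x + s * φ t) u = φ τ := by
    intro u hu hτT
    rw [tradedVolume_eq_totalVar _ (hτ.trans hu), totalVar_signed hs hφ h0
      ⟨le_min (hτ.trans hu) hT, min_le_right _ _⟩]
    exact hc _ (le_min hu hτT)
  -- With this `ε` the window starts exactly at `τ`, from where the traded volume is constant.
  have := ht.2 (t - τ) (sub_pos.2 h)
  rw [key _ (by linarith) (h.le.trans ht.1.2), key _ (by linarith) (h.le.trans ht.1.2)] at this
  exact lt_irrefl _ this

variable {Ω : Type*}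

/-! ### Independence -/

section Independence

variable {m m' mΩ : MeasurableSpace Ω} {μ : Measure Ω} [IsProbabilityMeasure μ]

/-- Intersections `A ∩ F` form a π-system generating the join; split off `A` first, then separate
`F` from `C`. It is applied to targets, Brownian past and a future increment. -/
lemma indep_sup_left_of_indep {m₁ m₂ m₃ : MeasurableSpace Ω} (h₁ : m₁ ≤ mΩ) (h₂ : m₂ ≤ mΩ)
    (h₃ : m₃ ≤ mΩ) (h : Indep m₁ (m₂ ⊔ m₃) μ) (h' : Indep m₂ m₃ μ) : Indep (m₁ ⊔ m₂) m₃ μ := by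
  let p : Set (Set Ω) := {s | ∃ A F, MeasurableSet[m₁] A ∧ MeasurableSet[m₂] F ∧ s = A ∩ F}
  have hp : m₁ ⊔ m₂ = MeasurableSpace.generateFrom p := by
    refine le_antisymm (sup_le ?_ ?_) (MeasurableSpace.generateFrom_le ?_)
    · exact fun A hA => .basic _ ⟨A, univ, hA, .univ, (inter_univ A).symm⟩
    · exact fun F hF => .basic _ ⟨univ, F, .univ, hF, (univ_inter F).symm⟩
    · rintro _ ⟨A, F, hA, hF, rfl⟩
      exact MeasurableSet.inter ((le_sup_left : m₁ ≤ m₁ ⊔ m₂) _ hA)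
        ((le_sup_right : m₂ ≤ m₁ ⊔ m₂) _ hF)
  have hpi : IsPiSystem p := by
    rintro _ ⟨A, F, hA, hF, rfl⟩ _ ⟨A', F', hA', hF', rfl⟩ -
    exact ⟨A ∩ A', F ∩ F', hA.inter hA', hF.inter hF', inter_inter_inter_comm _ _ _ _⟩
  rw [hp, ← @MeasurableSpace.generateFrom_measurableSet Ω m₃]
  refine IndepSets.indep' ?_ (fun s hs => h₃ _ hs) hpi
    (@MeasurableSpace.isPiSystem_measurableSet Ω m₃) ?_
  · rintro _ ⟨A, F, hA, hF, rfl⟩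
    exact (h₁ _ hA).inter (h₂ _ hF)
  rw [IndepSets_iff]
  rintro _ C ⟨A, F, hA, hF, rfl⟩ hC
  rw [Indep_iff] at h h'
  have hF' := (le_sup_left : m₂ ≤ m₂ ⊔ m₃) _ hF
  have hC' := (le_sup_right : m₃ ≤ m₂ ⊔ m₃) _ hC
  rw [inter_assoc, h _ _ hA (MeasurableSet.inter hF' hC'), h' _ _ hF hC, h _ _ hA hF', mul_assoc]

omit [IsProbabilityMeasure μ] in
lemma nullSets_le : nullSets μ ≤ mΩ := MeasurableSpace.generateFrom_le fun _ h => h.1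

omit [IsProbabilityMeasure μ] in
-- Every set of the augmented σ-algebra is almost everywhere equal to a set of `m`.
lemma indep_sup_nullSets (h : Indep m m' μ) :
    Indep (m ⊔ nullSets μ) m' μ := by
  rw [Indep_iff] at h ⊢
  intro s t hs ht
  have hle : m ⊔ nullSets μ ≤ @eventuallyMeasurableSpace Ω m (ae μ) _ := by
    refine sup_le le_eventuallyMeasurableSpace (MeasurableSpace.generateFrom_le ?_)
    exact fun N hN => ⟨∅, @MeasurableSet.empty _ m, ae_eq_empty.2 hN.2⟩
  obtain ⟨s', hs', hss⟩ := hle _ hs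
  rw [measure_congr (hss.inter (ae_eq_refl t)), measure_congr hss, h _ _ hs' ht]

end Independence

/-! ### Itô integrals have mean zero -/

/-- The filtration `𝔾` does not anticipate the increments of `B`. -/
structure IsBrownianFor [mΩ : MeasurableSpace Ω] (μ : Measure Ω) (𝔾 : ℝ → MeasurableSpace Ω)
    (T : ℝ) (B : ℝ → Ω → ℝ) : Prop where
  le : ∀ t ∈ Icc (0 : ℝ) T, 𝔾 t ≤ mΩ
  mono : ∀ s t : ℝ, 0 ≤ s → s ≤ t → t ≤ T → 𝔾 s ≤ 𝔾 t
  gaussian : ∀ s t : ℝ, 0 ≤ s → s ≤ t → t ≤ T →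
    HasLaw (fun ω => B t ω - B s ω) (gaussianReal 0 (t - s).toNNReal) μ
  indep : ∀ s t : ℝ, 0 ≤ s → s ≤ t → t ≤ T →
    Indep (𝔾 s) (MeasurableSpace.comap (fun ω => B t ω - B s ω) inferInstance) μ

section Ito

variable {m : MeasurableSpace Ω} [mΩ : MeasurableSpace Ω] {μ : Measure Ω} [IsProbabilityMeasure μ]
  {𝔾 : ℝ → MeasurableSpace Ω} {T : ℝ} {B : ℝ → Ω → ℝ}

omit [IsProbabilityMeasure μ] in
lemma IsBrownianFor.memLp_increment (hB : IsBrownianFor μ 𝔾 T B) {s t : ℝ} (hs : 0 ≤ s)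
    (hst : s ≤ t) (ht : t ≤ T) : MemLp (fun ω => B t ω - B s ω) 2 μ := by
  have h := hB.gaussian s t hs hst ht
  have h2 : MemLp id 2 (Measure.map (fun ω => B t ω - B s ω) μ) := by
    rw [h.map_eq]
    exact memLp_id_gaussianReal' 2 (by norm_num)
  exact (memLp_map_measure_iff aestronglyMeasurable_id h.aemeasurable).1 h2

omit mΩ in
lemma SimpleIntegrand.integral_horizon (H : SimpleIntegrand 𝔾 T) (ω : Ω) :
    H.integral B T ω = ∑ j ∈ Finset.range H.num,
      H.val j ω * (B (H.time (j + 1)) ω - B (H.time j) ω) := by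
  simp only [SimpleIntegrand.integral, min_eq_left (H.time_mem _).2]

omit [IsProbabilityMeasure μ] in
lemma SimpleIntegrand.memLp_term (hB : IsBrownianFor μ 𝔾 T B) (H : SimpleIntegrand 𝔾 T) (j : ℕ) :
    MemLp (fun ω => H.val j ω * (B (H.time (j + 1)) ω - B (H.time j) ω)) 2 μ := by
  obtain ⟨C, hC⟩ := H.val_bdd j
  have hi := hB.memLp_increment (H.time_mem j).1 (H.time_mono j.le_succ) (H.time_mem (j + 1)).2
  refine hi.of_le_mul (c := C) ?_ (ae_of_all _ fun ω => ?_)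
  · exact ((H.val_meas j).mono (hB.le _ (H.time_mem j)) le_rfl).aestronglyMeasurable.mul
      hi.aestronglyMeasurable
  · rw [norm_mul]
    exact mul_le_mul_of_nonneg_right (hC ω) (norm_nonneg _)

omit [IsProbabilityMeasure μ] in
lemma SimpleIntegrand.memLp_integral (hB : IsBrownianFor μ 𝔾 T B) (H : SimpleIntegrand 𝔾 T) :
    MemLp (H.integral B T) 2 μ := by
  rw [show H.integral B T = _ from funext H.integral_horizon]
  exact memLp_finsetSum _ fun j _ => H.memLp_term hB j

/-- In each term the indicator of `G` times the coefficient is known at the left time, hence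
independent of the centred increment. -/
lemma SimpleIntegrand.setIntegral_eq_zero (hB : IsBrownianFor μ 𝔾 T B) (H : SimpleIntegrand 𝔾 T)
    {G : Set Ω} (hG : MeasurableSet[𝔾 0] G) : ∫ ω in G, H.integral B T ω ∂μ = 0 := by
  simp only [H.integral_horizon]
  rw [integral_finsetSum _ fun j _ => ((H.memLp_term hB j).integrable (by norm_num)).integrableOn]
  refine Finset.sum_eq_zero fun j _ => ?_
  have hj := H.time_mem j
  have hle : H.time j ≤ H.time (j + 1) := H.time_mono j.le_succ
  have hj' := (H.time_mem (j + 1)).2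
  have hGj : MeasurableSet[𝔾 (H.time j)] G := hB.mono 0 _ le_rfl hj.1 hj.2 _ hG
  have hξ : Measurable[𝔾 (H.time j)] (G.indicator (H.val j)) := (H.val_meas j).indicator hGj
  have hind : IndepFun (G.indicator (H.val j))
      (fun ω => B (H.time (j + 1)) ω - B (H.time j) ω) μ := by
    rw [IndepFun_iff_Indep]
    exact indep_of_indep_of_le_left (hB.indep _ _ hj.1 hle hj') hξ.comap_le
  have hi := hB.memLp_increment hj.1 hle hj'
  have h0 : ∫ ω, (B (H.time (j + 1)) ω - B (H.time j) ω) ∂μ = 0 := by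
    rw [(hB.gaussian _ _ hj.1 hle hj').integral_eq, integral_id_gaussianReal]
  rw [← integral_indicator (hB.le _ hj _ hGj)]
  have := hind.integral_fun_mul_eq_mul_integral
    (hξ.mono (hB.le _ hj) le_rfl).aestronglyMeasurable hi.aestronglyMeasurable
  rw [h0, mul_zero] at this
  rw [← this]
  congr 1 with ω
  by_cases hω : ω ∈ G <;> simp [hω]

omit [IsProbabilityMeasure μ] in
lemma eLpNorm_two_eq (f : Ω → ℝ) : eLpNorm f 2 μ = (∫⁻ ω, ‖f ω‖ₑ ^ 2 ∂μ) ^ (1 / 2 : ℝ) := by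
  rw [eLpNorm_eq_lintegral_rpow_enorm_toReal (by norm_num) (by norm_num)]
  simp

variable {H I : ℝ → Ω → ℝ}

omit [IsProbabilityMeasure μ] in
lemma IsItoIntegral.memLp (hB : IsBrownianFor μ 𝔾 T B) (hT : 0 ≤ T)
    (hI : IsItoIntegral μ 𝔾 T B H I) : MemLp (I T) 2 μ := by
  have hm : AEStronglyMeasurable (I T) μ :=
    ((hI.adapted T ⟨hT, le_rfl⟩).mono (hB.le T ⟨hT, le_rfl⟩) le_rfl).aestronglyMeasurable
  obtain ⟨Φ, -, hΦ⟩ := hI.approx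
  -- A single approximation with finite `L²` error suffices; the bound `1` is arbitrary.
  obtain ⟨k, hk⟩ := ((hΦ T ⟨hT, le_rfl⟩).eventually (gt_mem_nhds zero_lt_one)).exists
  have hΦk := (Φ k).memLp_integral hB
  have hd : MemLp ((Φ k).integral B T - I T) 2 μ := by
    refine ⟨hΦk.aestronglyMeasurable.sub hm, ?_⟩
    rw [eLpNorm_two_eq]
    exact ENNReal.rpow_lt_top_of_nonneg (by norm_num) (hk.trans ENNReal.one_lt_top).ne
  simpa using hΦk.sub hd

/-- On a probability space `L²` convergence implies `L¹` convergence, which carries the vanishing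
set integrals of simple processes to the limit. -/
lemma IsItoIntegral.setIntegral_eq_zero (hB : IsBrownianFor μ 𝔾 T B) (hT : 0 ≤ T)
    (hI : IsItoIntegral μ 𝔾 T B H I) {G : Set Ω} (hG : MeasurableSet[𝔾 0] G) :
    ∫ ω in G, I T ω ∂μ = 0 := by
  have hIT := hI.memLp hB hT
  obtain ⟨Φ, -, hΦ⟩ := hI.approx
  have h1 : Tendsto (fun k => eLpNorm ((Φ k).integral B T - I T) 1 μ) atTop (𝓝 0) := by
    refine tendsto_of_tendsto_of_tendsto_of_le_of_le tendsto_const_nhds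
      (h := fun k => eLpNorm ((Φ k).integral B T - I T) 2 μ) ?_ (fun _ => zero_le) fun k =>
        eLpNorm_le_eLpNorm_of_exponent_le (by norm_num)
          (((Φ k).memLp_integral hB).sub hIT).aestronglyMeasurable
    simp only [eLpNorm_two_eq]
    simpa using (hΦ T ⟨hT, le_rfl⟩).ennrpow_const (1 / 2 : ℝ)
  refine tendsto_nhds_unique (tendsto_setIntegral_of_L1' _ hIT.aestronglyMeasurable
    (Eventually.of_forall fun k => ((Φ k).memLp_integral hB).integrable (by norm_num)) h1 G) ?_
  simp only [fun k => (Φ k).setIntegral_eq_zero hB hG]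
  exact tendsto_const_nhds

omit [IsProbabilityMeasure μ] in
-- The default value `0` also starts at zero, is square-integrable and has conditional mean zero, so
-- no existence theorem for the integral is needed.
lemma itoIntegral_cases (μ : Measure Ω) (𝔾 : ℝ → MeasurableSpace Ω) (T : ℝ) (B H : ℝ → Ω → ℝ) :
    IsItoIntegral μ 𝔾 T B H (itoIntegral μ 𝔾 T B H) ∨ itoIntegral μ 𝔾 T B H = 0 := by
  unfold itoIntegral
  split_ifs with h
  · exact .inl h.choose_spec
  · exact .inr rfl

omit [IsProbabilityMeasure μ] in
lemma itoIntegral_zero (ω : Ω) : itoIntegral μ 𝔾 T B H 0 ω = 0 := by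
  rcases itoIntegral_cases μ 𝔾 T B H with h | h
  · exact h.zero ω
  · simp [h]

omit [IsProbabilityMeasure μ] in
lemma memLp_itoIntegral (hB : IsBrownianFor μ 𝔾 T B) (hT : 0 ≤ T) :
    MemLp (itoIntegral μ 𝔾 T B H T) 2 μ := by
  rcases itoIntegral_cases μ 𝔾 T B H with h | h
  · exact h.memLp hB hT
  · rw [h]
    exact MemLp.zero

lemma condExp_itoIntegral (hB : IsBrownianFor μ 𝔾 T B) (hT : 0 ≤ T)
    (hm : m ≤ 𝔾 0) : μ[itoIntegral μ 𝔾 T B H T | m] =ᵐ[μ] 0 := by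
  rcases itoIntegral_cases μ 𝔾 T B H with h | h
  · refine (ae_eq_condExp_of_forall_setIntegral_eq (hm.trans (hB.le 0 ⟨le_rfl, hT⟩))
      ((h.memLp hB hT).integrable (by norm_num)) (fun s _ _ => integrableOn_zero)
      (fun s hs _ => ?_) aestronglyMeasurable_zero).symm
    simp [h.setIntegral_eq_zero hB hT (hm _ hs)]
  · rw [h]
    simp

end Ito

/-! ### Conditional expectations with values in `[-∞, ∞]` -/

section CondExpE

variable {m : MeasurableSpace Ω} [mΩ : MeasurableSpace Ω] {μ : Measure Ω}

lemma condExpE_mono {f g : Ω → ℝ} (h : f ≤ᵐ[μ] g) : condExpE μ m f ≤ᵐ[μ] condExpE μ m g := by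
  have h1 : condLExp m μ (fun ω => ENNReal.ofReal (f ω)) ≤ᵐ[μ]
      condLExp m μ (fun ω => ENNReal.ofReal (g ω)) :=
    condLExp_mono (h.mono fun ω hω => ENNReal.ofReal_le_ofReal hω)
  have h2 : condLExp m μ (fun ω => ENNReal.ofReal (-g ω)) ≤ᵐ[μ]
      condLExp m μ (fun ω => ENNReal.ofReal (-f ω)) :=
    condLExp_mono (h.mono fun ω hω => ENNReal.ofReal_le_ofReal (neg_le_neg hω))
  filter_upwards [h1, h2] with ω h1 h2
  exact EReal.sub_le_sub (EReal.coe_ennreal_le_coe_ennreal_iff.2 h1)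
    (EReal.coe_ennreal_le_coe_ennreal_iff.2 h2)

/-- Both parts have finite conditional expectations, so the extended subtraction is a real one. -/
lemma condExpE_ae_eq {f : Ω → ℝ} (hf : Integrable f μ) :
    condExpE μ m f =ᵐ[μ] fun ω => ((μ[f | m] ω : ℝ) : EReal) := by
  have aux : ∀ g : Ω → ℝ, Integrable g μ →
      condLExp m μ (fun ω => ENNReal.ofReal (g ω)) =ᵐ[μ]
        fun ω => ENNReal.ofReal (μ[fun ω => max (g ω) 0 | m] ω) := fun g hg => by
    have := condLExp_ofReal m hg.pos_part (ae_of_all _ fun ω => le_max_right (g ω) 0)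
    simpa [ENNReal.ofReal_max] using this
  have hsub : μ[f | m] =ᵐ[μ]
      μ[fun ω => max (f ω) 0 | m] - μ[fun ω => max (-f ω) 0 | m] := by
    rw [show f = (fun ω => max (f ω) 0) - fun ω => max (-f ω) 0 from funext fun ω =>
      (max_zero_sub_max_neg_zero_eq_self (f ω)).symm]
    simpa using condExp_sub hf.pos_part hf.neg_part m
  have hp : 0 ≤ᵐ[μ] μ[fun ω => max (f ω) 0 | m] :=
    condExp_nonneg (ae_of_all _ fun ω => le_max_right _ _)
  have hn : 0 ≤ᵐ[μ] μ[fun ω => max (-f ω) 0 | m] :=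
    condExp_nonneg (ae_of_all _ fun ω => le_max_right _ _)
  filter_upwards [aux f hf, aux (fun ω => -f ω) hf.neg, hsub, hp, hn] with ω h1 h2 h3 h4 h5
  simp only [Pi.zero_apply] at h4 h5
  rw [condExpE, h1, h2, h3, EReal.coe_ennreal_ofReal, EReal.coe_ennreal_ofReal, max_eq_left h4,
    max_eq_left h5, Pi.sub_apply, EReal.coe_sub]

/-- Only `g` and `M` need be integrable: `f` enters through monotonicity alone, as a competitor's
payoff may have conditional expectation `-∞`. -/
lemma condExpE_le_of_le_add {f g M : Ω → ℝ} (hg : Integrable g μ) (hM : Integrable M μ)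
    (h0 : μ[M | m] =ᵐ[μ] 0) (h : ∀ᵐ ω ∂μ, f ω ≤ g ω + M ω) :
    condExpE μ m f ≤ᵐ[μ] condExpE μ m g := by
  refine (condExpE_mono (g := g + M) h).trans (EventuallyEq.le ?_)
  filter_upwards [condExpE_ae_eq (m := m) (hg.add hM), condExpE_ae_eq (m := m) hg,
    condExp_add hg hM m, h0] with ω h1 h2 h3 h4
  rw [h1, h2, h3, Pi.add_apply, h4, Pi.zero_apply, add_zero]

end CondExpE

/-! ### Signs, histories and path measurability -/

/-- The sign of a real number, with value `1` at `0`. -/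
def signOf (x : ℝ) : ℝ :=
  open scoped Classical in if 0 ≤ x then 1 else -1

lemma signOf_sq (x : ℝ) : signOf x ^ 2 = 1 := by
  unfold signOf
  split_ifs <;> norm_num

lemma abs_signOf (x : ℝ) : |signOf x| = 1 := by
  unfold signOf
  split_ifs <;> norm_num

lemma signOf_mul_abs (x : ℝ) : signOf x * |x| = x := by
  unfold signOf
  split_ifs with h
  · rw [abs_of_nonneg h, one_mul]
  · rw [abs_of_neg (not_le.1 h)]
    ring

lemma measurable_signOf : Measurable signOf :=
  Measurable.ite measurableSet_Ici measurable_const measurable_const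

lemma measurable_history (X : ℝ → Ω → ℝ) {u t : ℝ} (h0 : 0 ≤ u) (h : u ≤ t) :
    Measurable[history X t] (X u) :=
  Measurable.of_comap_le
    (le_iSup₂ (f := fun u (_ : u ∈ Icc 0 t) => MeasurableSpace.comap (X u) inferInstance) u ⟨h0, h⟩)

lemma history_mono (X : ℝ → Ω → ℝ) {s t : ℝ} (h : s ≤ t) : history X s ≤ history X t :=
  biSup_mono fun _ hu => ⟨hu.1, hu.2.trans h⟩

lemma history_zero_le {X : ℝ → Ω → ℝ} {𝓖 : MeasurableSpace Ω} (h : Measurable[𝓖] (X 0)) :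
    history X 0 ≤ 𝓖 := by
  refine iSup₂_le fun u hu => ?_
  rw [show u = 0 from le_antisymm hu.2 hu.1]
  exact h.comap_le

lemma ProgMeasurableOn.mono {𝔾 𝔾' : ℝ → MeasurableSpace Ω} {T : ℝ} {H : ℝ → Ω → ℝ}
    (h : ProgMeasurableOn 𝔾 T H) (hle : ∀ t, 𝔾 t ≤ 𝔾' t) : ProgMeasurableOn 𝔾' T H :=
  fun t ht => (h t ht).mono (sup_le_sup le_rfl (MeasurableSpace.comap_mono (hle t))) le_rfl

/-- Joint measurability is available only over the subtype of times, so the time integral is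
rewritten over that subtype, whose measure is finite, before Tonelli applies. -/
lemma measurable_pathEnergy [MeasurableSpace Ω] {T : ℝ} {H : ℝ → Ω → ℝ}
    (h : Measurable fun p : Icc (0 : ℝ) T × Ω => H p.1 p.2) :
    Measurable fun ω => ∫⁻ u in Icc (0 : ℝ) T, ‖H u ω‖ₑ ^ 2 := by
  have : IsFiniteMeasure (Measure.comap (Subtype.val : Icc (0 : ℝ) T → ℝ) volume) := by
    constructor
    rw [(MeasurableEmbedding.subtype_coe measurableSet_Icc).comap_apply]
    exact (measure_mono (t := Icc 0 T) (by simp [Icc_def])).trans_lt (measure_Icc_lt_top (a := (0 : ℝ)) (b := T))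
  have h1 : Measurable fun ω => ∫⁻ u : Icc (0 : ℝ) T, ‖H u ω‖ₑ ^ 2
      ∂(Measure.comap (Subtype.val : Icc (0 : ℝ) T → ℝ) volume) :=
    Measurable.lintegral_prod_left' (f := fun p : Icc (0 : ℝ) T × Ω => ‖H p.1 p.2‖ₑ ^ 2)
      (h.enorm.pow_const 2)
  convert h1 using 2 with ω
  exact (lintegral_subtype_comap measurableSet_Icc fun u => ‖H u ω‖ₑ ^ 2).symm

lemma measurable_linear_drift [MeasurableSpace Ω] {t n c : ℝ} {k g : ℝ → ℝ} {x : Ω → ℝ}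
    (hk : Measurable k) (hg : Measurable g) (hx : Measurable x) :
    Measurable fun p : Icc (0 : ℝ) t × Ω =>
      -(1 / 2) * (k p.1 * (g p.1 * (x p.2 - n) - c * n)) := by
  have h1 : Measurable fun p : Icc (0 : ℝ) t × Ω => (p.1 : ℝ) :=
    measurable_subtype_coe.comp measurable_fst
  exact ((hk.comp h1).mul (((hg.comp h1).mul ((hx.comp measurable_snd).sub_const n)).sub_const
    (c * n))).const_mul _

/-! ### Consequences of the standing assumptions -/

namespace Market

variable [mΩ : MeasurableSpace Ω] {μ : Measure Ω} {m : Market Ω}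

lemma Standing.penalty (hm : m.Standing μ) : IsPenalty m.T m.κ m.γ where
  T_pos := hm.T_pos
  κ_pos := hm.κ_pos
  κ_int := (integrableOn_Icc_iff_integrableOn_Ioo).2 hm.κ_int
  γ_mem := hm.γ_mem
  γ_mono := hm.γ_mono
  γ_cadlag := hm.γ_cadlag

lemma Standing.historyB_le (hm : m.Standing μ) : history m.B m.T ≤ mΩ :=
  iSup₂_le fun u hu => (hm.brownian.measurable u hu).comap_le

lemma Standing.targets_le (hm : m.Standing μ) : m.targets ≤ mΩ :=
  sup_le (hm.a_meas 0).comap_le (hm.a_meas 1).comap_le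

omit mΩ in
lemma measurable_a (m : Market Ω) (i : Fin 2) : Measurable[m.targets] (m.a i) := by
  fin_cases i
  · exact Measurable.of_comap_le le_sup_left
  · exact Measurable.of_comap_le le_sup_right

omit mΩ in
lemma measurable_aSum (m : Market Ω) : Measurable[m.targets] m.aSum :=
  (m.measurable_a 0).add (m.measurable_a 1)

omit mΩ in
lemma measurable_A (m : Market Ω) (i : Fin 2) : Measurable[m.targets] (m.A i) :=
  (m.measurable_a i).sub (m.measurable_aSum.div_const 2)

lemma Standing.memLp_aSum (hm : m.Standing μ) : MemLp m.aSum 2 μ := (hm.a_sq 0).add (hm.a_sq 1)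

lemma Standing.memLp_A (hm : m.Standing μ) (i : Fin 2) : MemLp (m.A i) 2 μ := by
  have := (hm.a_sq i).sub (hm.memLp_aSum.const_mul (1 / 2))
  convert this using 1
  ext ω
  simp only [A, Pi.sub_apply]
  ring

lemma Standing.indep_targets_brownian [IsProbabilityMeasure μ] (hm : m.Standing μ) :
    Indep m.targets (m.brownianFiltration μ m.T) μ :=
  (indep_sup_nullSets hm.indep.symm).symm

/-- Enlarging by targets independent of `B`, and by null sets, keeps future increments independent
of the past. -/
lemma Standing.brownianFor [IsProbabilityMeasure μ] (hm : m.Standing μ) :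
    IsBrownianFor μ (m.fullFiltration μ) m.T m.B where
  le t ht := sup_le hm.targets_le (sup_le ((history_mono _ ht.2).trans hm.historyB_le) nullSets_le)
  mono s t _ hst _ := sup_le_sup le_rfl (sup_le_sup (history_mono _ hst) le_rfl)
  gaussian := hm.brownian.gaussian
  indep s t hs hst ht := by
    have hinc : MeasurableSpace.comap (fun ω => m.B t ω - m.B s ω) inferInstance ≤
        history m.B m.T := Measurable.comap_le
      ((measurable_history m.B (hs.trans hst) ht).sub (measurable_history m.B hs (hst.trans ht)))
    have hs' : history m.B s ≤ history m.B m.T := history_mono _ (hst.trans ht)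
    rw [fullFiltration, brownianFiltration, ← sup_assoc]
    refine indep_sup_nullSets (indep_sup_left_of_indep hm.targets_le (hs'.trans hm.historyB_le)
      (hinc.trans hm.historyB_le) (indep_of_indep_of_le_right hm.indep (sup_le hs' hinc)) ?_)
    exact (hm.brownian.indep s t hs hst ht).symm

/-! ### The stock price -/

lemma price_zero (m : Market Ω) (μ : Measure Ω) (c1 : ℝ) (ω : Ω) :
    m.price μ c1 0 ω = (∫ ω', m.D ω' ∂μ) +
      1 / 2 * ∫ u in (0 : ℝ)..m.T, m.κ u * (m.γ u * (m.aSum ω - m.n) - c1 * m.n) := by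
  rw [price, stochInt, itoIntegral_zero, add_zero]

lemma Standing.bdd_drift (hm : m.Standing μ) (c1 x : ℝ) :
    IsBddMeasOn m.T (fun u => m.γ u * (x - m.n) - c1 * m.n) :=
  (hm.penalty.γ_bdd.mul (.const _ _)).sub (.const _ _)

lemma Standing.price_zero_eq (hm : m.Standing μ) (c1 : ℝ) (ω : Ω) :
    m.price μ c1 0 ω = (∫ ω', m.D ω' ∂μ) +
      1 / 2 * ((m.aSum ω - m.n) * (∫ u in (0 : ℝ)..m.T, m.κ u * m.γ u) -
        c1 * m.n * ∫ u in (0 : ℝ)..m.T, m.κ u) := by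
  have hP := hm.penalty
  rw [price_zero, hP.integral_sub_const (hP.γ_bdd.mul (.const _ _)) _ hP.zero_mem hP.T_mem]
  simp only [← mul_assoc, intervalIntegral.integral_mul_const]
  ring

lemma Standing.price_eq (hm : m.Standing μ) (c1 : ℝ) {t : ℝ} (ht : t ∈ Icc 0 m.T) (ω : Ω) :
    m.price μ c1 t ω = m.price μ c1 0 ω -
      1 / 2 * (∫ u in (0 : ℝ)..t, m.κ u * (m.γ u * (m.aSum ω - m.n) - c1 * m.n)) +
        m.stochInt μ m.σ t ω := by
  have hP := hm.penalty
  rw [price_zero, price, ← intervalIntegral.integral_add_adjacent_intervals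
    (hP.intervalIntegrable (hm.bdd_drift c1 (m.aSum ω)) hP.zero_mem ht)
    (hP.intervalIntegrable (hm.bdd_drift c1 (m.aSum ω)) ht hP.T_mem)]
  ring

lemma Standing.measurable_price_zero (hm : m.Standing μ) (c1 : ℝ) :
    Measurable[m.targets] (m.price μ c1 0) := by
  rw [show m.price μ c1 0 = _ from funext (hm.price_zero_eq c1)]
  exact ((((m.measurable_aSum.sub_const _).mul_const _).sub_const _).const_mul _).const_add _

lemma Standing.info_zero_le (hm : m.Standing μ) (c1 : ℝ) (i : Fin 2) :
    m.info (m.price μ c1) i 0 ≤ m.targets :=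
  sup_le (m.measurable_a i).comap_le (history_zero_le (hm.measurable_price_zero c1))

/-- The initial price is affine in `aSum` with slope half this integral, so it can be inverted. -/
lemma Standing.measurable_aSum_info (hm : m.Standing μ) (c1 : ℝ) (i : Fin 2) {t : ℝ} (ht : 0 ≤ t)
    (h : ∫ u in (0 : ℝ)..m.T, m.κ u * m.γ u ≠ 0) :
    Measurable[m.info (m.price μ c1) i t] m.aSum := by
  have h1 : Measurable[m.info (m.price μ c1) i t] (m.price μ c1 0) :=
    (measurable_history _ le_rfl ht).mono le_sup_right le_rfl
  have h2 : m.aSum = fun ω => ((m.price μ c1 0 ω - ∫ ω', m.D ω' ∂μ) * 2 +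
      c1 * m.n * ∫ u in (0 : ℝ)..m.T, m.κ u) / (∫ u in (0 : ℝ)..m.T, m.κ u * m.γ u) + m.n := by
    ext ω
    rw [hm.price_zero_eq]
    field_simp
    ring
  rw [h2]
  exact ((((h1.sub_const _).mul_const _).add_const _).div_const _).add_const _

omit mΩ in
lemma measurable_a_info (m : Market Ω) (S : ℝ → Ω → ℝ) (i : Fin 2) (t : ℝ) :
    Measurable[m.info S i t] (m.a i) := Measurable.of_comap_le le_sup_left

lemma Standing.info_eq (hm : m.Standing μ) (c1 : ℝ) {t : ℝ} (ht : 0 ≤ t)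
    (h : ∫ u in (0 : ℝ)..m.T, m.κ u * m.γ u ≠ 0) :
    m.info (m.price μ c1) 0 t = m.info (m.price μ c1) 1 t := by
  refine le_antisymm (sup_le ?_ le_sup_right) (sup_le ?_ le_sup_right)
  · have : m.a 0 = fun ω => m.aSum ω - m.a 1 ω := by ext ω; simp [aSum]
    rw [this]
    exact ((hm.measurable_aSum_info c1 1 ht h).sub (m.measurable_a_info _ 1 t)).comap_le
  · have : m.a 1 = fun ω => m.aSum ω - m.a 0 ω := by ext ω; simp [aSum]
    rw [this]
    exact ((hm.measurable_aSum_info c1 0 ht h).sub (m.measurable_a_info _ 0 t)).comap_le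

lemma Standing.integral_γ_pos (hm : m.Standing μ) (h : ∃ t ∈ Ico 0 m.T, 0 < m.γ t) :
    0 < ∫ u in (0 : ℝ)..m.T, m.κ u * m.γ u := by
  obtain ⟨t, ht, hγ⟩ := h
  have hP := hm.penalty
  have htm : t ∈ Icc 0 m.T := Ico_subset_Icc_self ht
  have h1 := hP.tail_antitoneOn hP.γ_bdd (fun u hu => (hP.γ_mem u (Ioo_subset_Icc_self hu)).1)
    hP.zero_mem htm ht.1
  refine lt_of_lt_of_le ?_ h1
  refine intervalIntegral.intervalIntegral_pos_of_pos_on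
    (hP.intervalIntegrable hP.γ_bdd htm hP.T_mem) (fun u hu => ?_) ht.2
  have hu' : u ∈ Icc 0 m.T := ⟨ht.1.trans hu.1.le, hu.2.le⟩
  exact mul_pos (hP.κ_pos u ⟨ht.1.trans_lt hu.1, hu.2⟩)
    (hγ.trans_le (hP.γ_mono htm hu' hu.1.le))

lemma Standing.isIto_price [IsProbabilityMeasure μ] (hm : m.Standing μ) (c1 : ℝ) :
    IsIeval μ (m.fullFiltration μ) m.T m.B m.σ (m.price μ c1) := by
  have hP := hm.penalty
  have hσ : ProgMeasurableOn (m.fullFiltration μ) m.T m.σ :=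
    hm.σ_prog.mono fun t => le_sup_right
  -- Nothing is assumed of `κ` and `γ` off the horizon, so the drift is built from globally
  -- measurable modifications `k` and `g` that agree with them on `(0, T)`.
  let k : ℝ → ℝ := (Ioo 0 m.T).indicator m.κ
  let g : ℝ → ℝ := fun u => m.γ (projIcc 0 m.T hm.T_pos.le u)
  have hk : Measurable k := by
    refine measurable_of_restrict_of_restrict_compl (s := Ioo 0 m.T) measurableSet_Ioo ?_ ?_
    · convert! hm.κ_meas using 1
      ext u
      exact indicator_of_mem u.2 _
    · convert! measurable_const (a := (0 : ℝ)) using 1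
      ext u
      exact indicator_of_notMem u.2 _
  have hg : Measurable g := Monotone.measurable fun x y hxy =>
    hm.γ_mono (projIcc 0 m.T hm.T_pos.le x).2 (projIcc 0 m.T hm.T_pos.le y).2
      (monotone_projIcc hm.T_pos.le hxy)
  let b : ℝ → Ω → ℝ := fun u ω => -(1 / 2) * (k u * (g u * (m.aSum ω - m.n) - c1 * m.n))
  have hb : ∀ ω, ∀ u ∈ Ioo 0 m.T,
      b u ω = -(1 / 2) * (m.κ u * (m.γ u * (m.aSum ω - m.n) - c1 * m.n)) := by
    intro ω u hu
    simp only [b, k, g, indicator_of_mem hu, projIcc_of_mem hm.T_pos.le (Ioo_subset_Icc_self hu)]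
  have hae : ∀ ω, ∀ t ∈ Icc 0 m.T, ∀ᵐ u, u ∈ uIoc 0 t →
      -(1 / 2) * (m.κ u * (m.γ u * (m.aSum ω - m.n) - c1 * m.n)) = b u ω := by
    intro ω t ht
    filter_upwards [Measure.ae_ne volume m.T] with u hne hu
    rw [uIoc_of_le ht.1] at hu
    exact (hb ω u ⟨hu.1, lt_of_le_of_ne (hu.2.trans ht.2) hne⟩).symm
  refine ⟨(hm.measurable_price_zero c1).mono le_sup_left le_rfl, hσ, hm.σ_sq, b, ?_,
    ae_of_all _ fun ω => ?_, ae_of_all _ fun ω t ht => ?_⟩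
  · exact fun t _ => @measurable_linear_drift Ω (m.fullFiltration μ t) _ _ _ _ _ _ hk hg
      (m.measurable_aSum.mono le_sup_left le_rfl)
  · refine IntervalIntegrable.congr_ae ?_ ((ae_restrict_iff' measurableSet_uIoc).2
      (hae ω m.T hP.T_mem))
    exact (hP.intervalIntegrable (hm.bdd_drift c1 _) hP.zero_mem hP.T_mem).const_mul _
  · rw [hm.price_eq c1 ht, ← intervalIntegral.integral_congr_ae (hae ω t ht),
      intervalIntegral.integral_const_mul, stochInt]
    ring

lemma Standing.price_terminal (hm : m.Standing μ) (c1 : ℝ) :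
    ∀ᵐ ω ∂μ, m.price μ c1 m.T ω = m.D ω := by
  filter_upwards [hm.D_eq] with ω hω
  rw [hω, price, intervalIntegral.integral_same]
  ring

end Market

/-! ### The equilibrium holdings -/

namespace Market

variable [mΩ : MeasurableSpace Ω] {μ : Measure Ω} {m : Market Ω} {lam c1 : ℝ}

/-- The size of the frictionless target of agent `i`. -/
def size (m : Market Ω) (c1 : ℝ) (i : Fin 2) (ω : Ω) : ℝ := |m.A i ω| / (1 + c1)

omit mΩ in
lemma size_nonneg (hc1 : -(1 / 2) < c1) (i : Fin 2) (ω : Ω) : 0 ≤ m.size c1 i ω :=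
  div_nonneg (abs_nonneg _) (by linarith)

omit mΩ in
lemma A_one (m : Market Ω) (ω : Ω) : m.A 1 ω = -m.A 0 ω := by
  simp only [A, aSum]
  ring

omit mΩ in
lemma abs_A (m : Market Ω) (i : Fin 2) (ω : Ω) : |m.A i ω| = |m.A 0 ω| := by
  fin_cases i
  · rfl
  · exact (congrArg abs (m.A_one ω)).trans (abs_neg _)

omit mΩ in
lemma size_eq (m : Market Ω) (c1 : ℝ) (i j : Fin 2) (ω : Ω) :
    m.size c1 i ω = m.size c1 j ω := by
  rw [size, size, abs_A, abs_A _ j]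

omit mΩ in
lemma signOf_mul_size (m : Market Ω) (c1 : ℝ) (i : Fin 2) (ω : Ω) :
    signOf (m.A i ω) * m.size c1 i ω = m.A i ω / (1 + c1) := by
  rw [size, ← mul_div_assoc, signOf_mul_abs]

omit mΩ in
-- Moving the factor `1 + 2 * c1 > 0` into the cost translates the market quantities into those of
-- the deterministic problem.
lemma scaled_cost_le_iff (hc1 : -(1 / 2) < c1) (x v : ℝ) :
    x * ((1 + 2 * c1) / (1 + c1)) * v ≤ lam ↔ x / (1 + c1) * v ≤ lam / (1 + 2 * c1) := by
  rw [le_div_iff₀ (by linarith)]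
  ring_nf

omit mΩ in
lemma lastTradingTime_eq (hc1 : -(1 / 2) < c1) (i : Fin 2) (ω : Ω) :
    m.lastTradingTime lam c1 ω = exitTime m.κ m.γ m.T (lam / (1 + 2 * c1)) (m.size c1 i ω) := by
  simp only [lastTradingTime, exitTime, scaled_cost_le_iff hc1, size, abs_A m i]

omit mΩ in
lemma lt_chi_iff (hc1 : -(1 / 2) < c1) (i : Fin 2) (ω : Ω) :
    lam < m.chi c1 ω ↔
      lam / (1 + 2 * c1) < m.size c1 i ω * ∫ u in (0 : ℝ)..m.T, m.κ u * m.γ u := by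
  rw [chi, mul_div_assoc, ← not_le, scaled_cost_le_iff hc1, not_le, size, abs_A m i]

omit mΩ in
lemma holdings_eq (hlam : 0 < lam) (hc1 : -(1 / 2) < c1) (i : Fin 2)
    (t : ℝ) (ω : Ω) :
    m.holdings lam c1 i t ω = m.n / 2 + signOf (m.A i ω) *
      position m.κ m.γ m.T (lam / (1 + 2 * c1)) (m.size c1 i ω) t := by
  simp only [holdings, position, plateau, lastTradingTime_eq hc1 i, lt_chi_iff hc1 i]
  split_ifs with h1 h2
  · rw [← signOf_mul_size]
    ring
  -- In the trading regime `A i` cannot vanish, so `Real.sign` and `signOf` agree.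
  · have hne : m.A i ω ≠ 0 := by
      intro h0
      rw [size, h0] at h2
      simp only [abs_zero, zero_div, zero_mul] at h2
      exact absurd h2 (not_lt.2 (div_pos hlam (by linarith)).le)
    have hs : Real.sign (m.A i ω) = signOf (m.A i ω) := by
      unfold signOf
      rcases lt_or_gt_of_ne hne with h | h
      · rw [Real.sign_of_neg h, if_neg (not_le.2 h)]
      · rw [Real.sign_of_pos h, if_pos h.le]
    rw [hs, intervalIntegral.integral_mul_const, ← signOf_mul_size]
    ring
  · ring

omit mΩ in
lemma holdings_fun_eq (hlam : 0 < lam) (hc1 : -(1 / 2) < c1) (i : Fin 2)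
    (ω : Ω) :
    (fun t => m.holdings lam c1 i t ω) = fun t => m.n / 2 + signOf (m.A i ω) *
      position m.κ m.γ m.T (lam / (1 + 2 * c1)) (m.size c1 i ω) t :=
  funext fun t => holdings_eq hlam hc1 i t ω

variable (hm : m.Standing μ) (hlam : 0 < lam) (hc1 : -(1 / 2) < c1)
include hm hlam hc1

omit mΩ hm in
lemma cost_pos : 0 < lam / (1 + 2 * c1) := div_pos hlam (by linarith)

lemma measurable_holdings_info (i : Fin 2) {t : ℝ} (ht : t ∈ Icc 0 m.T) :
    Measurable[m.info (m.price μ c1) i t] (m.holdings lam c1 i t) := by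
  have hP := hm.penalty
  have hℓ := cost_pos hlam hc1
  rw [show m.holdings lam c1 i t = _ from funext (holdings_eq hlam hc1 i t)]
  -- If the price reveals nothing about `aSum`, then there is no trading either.
  by_cases h : ∫ u in (0 : ℝ)..m.T, m.κ u * m.γ u = 0
  · have h0 : ∀ ω, position m.κ m.γ m.T (lam / (1 + 2 * c1)) (m.size c1 i ω) t = 0 := fun ω => by
      have hle : m.size c1 i ω * ∫ u in (0 : ℝ)..m.T, m.κ u * m.γ u ≤ lam / (1 + 2 * c1) := by
        rw [h, mul_zero]
        exact hℓ.le
      rw [IsPenalty.position_of_ge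
        ((hP.exitTime_eq_zero hℓ (size_nonneg hc1 i ω) hle).le.trans ht.1), plateau,
        if_neg (not_lt.2 hle)]
    simp only [h0, mul_zero]
    exact measurable_const
  · have hA : Measurable[m.info (m.price μ c1) i t] (m.A i) :=
      (m.measurable_a_info _ i t).sub ((hm.measurable_aSum_info c1 i ht.1 h).div_const 2)
    exact ((measurable_signOf.comp hA).mul ((hP.measurable_position hℓ t).comp
      ((measurable_abs.comp hA).div_const _))).const_add _

lemma holdings_boundedVariationOn (i : Fin 2) (ω : Ω) :
    BoundedVariationOn (fun t => m.holdings lam c1 i t ω) (Icc 0 m.T) := by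
  rw [holdings_fun_eq hlam hc1]
  exact boundedVariationOn_signed (signOf_sq _) hm.T_pos.le
    (hm.penalty.position_mono (cost_pos hlam hc1) (size_nonneg hc1 i ω))

lemma abs_holdings_le (i : Fin 2) (ω : Ω) {t : ℝ} (ht : t ∈ Icc 0 m.T) :
    |m.holdings lam c1 i t ω| ≤ m.n / 2 + m.size c1 i ω := by
  have hℓ := cost_pos hlam hc1
  have hz := size_nonneg (m := m) hc1 i ω
  rw [holdings_eq hlam hc1]
  refine (abs_add_le _ _).trans ?_
  rw [abs_mul, abs_signOf, one_mul, abs_of_nonneg (hm.penalty.position_nonneg hℓ hz ht),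
    abs_of_pos (half_pos hm.n_pos)]
  exact add_le_add_right (hm.penalty.position_le hℓ hz ht) _

omit mΩ hm hlam hc1 in
lemma measurable_size (m : Market Ω) (c1 : ℝ) (i : Fin 2) : Measurable[m.targets] (m.size c1 i) :=
  (measurable_abs.comp (m.measurable_A i)).div_const _

omit hlam hc1 in
lemma memLp_size (i : Fin 2) : MemLp (m.size c1 i) 2 μ := by
  have := (hm.memLp_A i).abs.const_mul (1 / (1 + c1))
  convert this using 1
  ext ω
  simp only [size, one_div, Pi.abs_apply]
  ring

/-- The holding is bounded by a variable depending on the targets only, while `σ` is Brownian;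
independence factorises the expectation, so second moments suffice. -/
lemma energy_holdings_lt_top [IsProbabilityMeasure μ] (i : Fin 2) :
    energy μ m.T (fun t ω => m.σ t ω * m.holdings lam c1 i t ω) < ∞ := by
  have hz : MemLp (fun ω => m.n / 2 + m.size c1 i ω) 2 μ :=
    (memLp_const (m.n / 2)).add (memLp_size hm i)
  have hmz : Measurable[m.targets] fun ω => ‖m.n / 2 + m.size c1 i ω‖ₑ ^ 2 :=
    (measurable_id.pow_const 2).comp (measurable_enorm.comp ((m.measurable_size c1 i).const_add _))
  have hle : energy μ m.T (fun t ω => m.σ t ω * m.holdings lam c1 i t ω) ≤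
      ∫⁻ ω, ‖m.n / 2 + m.size c1 i ω‖ₑ ^ 2 * (∫⁻ u in Icc (0 : ℝ) m.T, ‖m.σ u ω‖ₑ ^ 2) ∂μ := by
    refine lintegral_mono fun ω => ?_
    rw [← lintegral_const_mul' _ _ (ENNReal.pow_ne_top enorm_ne_top)]
    refine setLIntegral_mono' measurableSet_Icc fun u hu => ?_
    rw [enorm_mul, mul_pow, mul_comm]
    gcongr
    rw [enorm_le_iff_norm_le, Real.norm_eq_abs, Real.norm_eq_abs]
    exact (abs_holdings_le hm hlam hc1 i ω hu).trans (le_abs_self _)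
  have hbr : m.brownianFiltration μ m.T ≤ mΩ := sup_le hm.historyB_le nullSets_le
  refine hle.trans_lt ?_
  rw [lintegral_mul_eq_lintegral_mul_lintegral_of_independent_measurableSpace hm.targets_le hbr
    hm.indep_targets_brownian hmz
    (@measurable_pathEnergy Ω (m.brownianFiltration μ m.T) _ _ (hm.σ_prog m.T hm.penalty.T_mem))]
  refine ENNReal.mul_lt_top ?_ hm.σ_sq
  have := hz.2
  rw [eLpNorm_two_eq] at this
  exact (ENNReal.rpow_lt_top_iff_of_pos (by norm_num)).1 this

lemma holdings_admissible [IsProbabilityMeasure μ] (i : Fin 2) :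
    m.Admissible μ (m.price μ c1) i (m.holdings lam c1 i) where
  adapted _ ht := measurable_holdings_info hm hlam hc1 i ht
  cadlag := ae_of_all _ fun ω => by
    rw [holdings_fun_eq hlam hc1]
    have h := hm.penalty.position_cadlag (ℓ := lam / (1 + 2 * c1)) (z := m.size c1 i ω)
    refine ⟨fun t ht => ((h.1 t ht).const_mul _).const_add _, fun t ht => ?_⟩
    obtain ⟨l, hl⟩ := h.2 t ht
    exact ⟨_, (hl.const_mul _).const_add _⟩
  finiteVar := ae_of_all _ fun ω => holdings_boundedVariationOn hm hlam hc1 i ω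
  sq_int := energy_holdings_lt_top hm hlam hc1 i

lemma holdings_clearing {t : ℝ} (ht : t ∈ Icc 0 m.T) (ω : Ω) :
    m.holdings lam c1 0 t ω + m.holdings lam c1 1 t ω = m.n := by
  have hℓ := cost_pos hlam hc1
  have hz := size_nonneg (m := m) hc1 0 ω
  rw [holdings_eq hlam hc1, holdings_eq hlam hc1, size_eq m c1 1 0, A_one]
  -- At `0` the function `signOf` is not odd, but the position vanishes there.
  by_cases h : m.A 0 ω = 0
  · have hp : position m.κ m.γ m.T (lam / (1 + 2 * c1)) (m.size c1 0 ω) t = 0 := by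
      refine le_antisymm ((hm.penalty.position_le hℓ hz ht).trans ?_)
        (hm.penalty.position_nonneg hℓ hz ht)
      rw [size, h]
      simp
    rw [hp]
    ring
  · have hs : signOf (-m.A 0 ω) = -signOf (m.A 0 ω) := by
      unfold signOf
      rcases lt_or_gt_of_ne h with h | h
      · rw [if_pos (by linarith), if_neg (not_le.2 h), neg_neg]
      · rw [if_neg (by linarith), if_pos h.le]
    rw [hs]
    ring

/-! ### The perceived price along the equilibrium -/

omit mΩ hm hlam in
-- On the target, `coeff2` cancels the dependence of the impact term on the individual `a i`, and
-- `coeff0` adjusts the remainder to the market drift.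
lemma perceivedDrift_of_target {i : Fin 2} {θ : ℝ → Ω → ℝ} {u : ℝ} {ω : Ω}
    (h : θ u ω = m.n / 2 + m.A i ω / (1 + c1) * m.γ u) :
    m.perceivedDrift (m.coeff0 c1) c1 (coeff2 c1) i θ u ω =
      -(1 / 2) * (m.κ u * (m.γ u * (m.aSum ω - m.n) - c1 * m.n)) := by
  have : 1 + c1 ≠ 0 := by linarith
  rw [perceivedDrift, h, coeff0, coeff2, A]
  field_simp
  ring

lemma perceivedPrice_eq (i : Fin 2) (ω : Ω) {t : ℝ} (ht : t ∈ Icc 0 m.T)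
    (hτ : t ≤ exitTime m.κ m.γ m.T (lam / (1 + 2 * c1)) (m.size c1 i ω)) :
    m.perceivedPrice μ (m.price μ c1) (m.coeff0 c1) c1 (coeff2 c1) i (m.holdings lam c1 i) t ω =
      m.price μ c1 t ω := by
  rw [perceivedPrice, hm.price_eq c1 ht]
  have : ∫ u in (0 : ℝ)..t,
      m.perceivedDrift (m.coeff0 c1) c1 (coeff2 c1) i (m.holdings lam c1 i) u ω =
      ∫ u in (0 : ℝ)..t, -(1 / 2) * (m.κ u * (m.γ u * (m.aSum ω - m.n) - c1 * m.n)) := by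
    refine intervalIntegral.integral_congr_ae ?_
    filter_upwards [Measure.ae_ne volume t] with u hne hu
    rw [uIoc_of_le ht.1] at hu
    refine perceivedDrift_of_target hc1 ?_
    rw [holdings_eq hlam hc1,
      IsPenalty.position_of_lt ((lt_of_le_of_ne hu.2 hne).trans_le hτ), ← mul_assoc,
      signOf_mul_size]
  rw [this, intervalIntegral.integral_const_mul]
  ring

/-- Trading stops at the exit time, which is common to both agents because their sizes coincide; up
to then both track their targets. -/
lemma holdings_consistent (ω : Ω) {t : ℝ}
    (ht : t ∈ tradeTimes (m.n / 2) m.T fun u => m.holdings lam c1 0 u ω) (i : Fin 2) :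
    m.perceivedPrice μ (m.price μ c1) (m.coeff0 c1) c1 (coeff2 c1) i (m.holdings lam c1 i) t ω =
      m.price μ c1 t ω := by
  have hℓ := cost_pos hlam hc1
  have hz := size_nonneg (m := m) hc1 0 ω
  refine perceivedPrice_eq hm hlam hc1 i ω ht.1 ?_
  rw [holdings_fun_eq hlam hc1] at ht
  rw [size_eq m c1 i 0]
  refine le_of_mem_tradeTimes (signOf_sq _) (hm.penalty.position_mono hℓ hz)
    (hm.penalty.position_nonneg hℓ hz hm.penalty.zero_mem) (hm.penalty.exitTime_mem hℓ).1
    (fun u hu => ?_) ht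
  rw [IsPenalty.position_of_ge hu, IsPenalty.position_of_ge le_rfl]

/-! ### The terminal payoff -/

omit hm hlam hc1 in
/-- The part of the payoff that does not depend on the strategy, up to the stochastic integral. -/
def basePayoff (m : Market Ω) (μ : Measure Ω) (c1 : ℝ) (i : Fin 2) (ω : Ω) : ℝ :=
  m.n / 2 * m.price μ c1 0 ω + (m.n * (c1 * m.n) / 4) * (∫ u in (0 : ℝ)..m.T, m.κ u) +
    (m.A i ω / (1 + c1) * (c1 * m.n) / 2 - m.n * (m.aSum ω - m.n) / 4) *
      (∫ u in (0 : ℝ)..m.T, m.κ u * m.γ u) +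
    (-(m.A i ω / (1 + c1) * (m.aSum ω - m.n)) / 2 -
      (m.a i ω - m.n / 2 - m.A i ω / (1 + c1)) ^ 2 / 2) *
      (∫ u in (0 : ℝ)..m.T, m.κ u * (m.γ u * m.γ u))

omit hlam hc1 in
lemma integrable_basePayoff [IsProbabilityMeasure μ] (i : Fin 2) :
    Integrable (m.basePayoff μ c1 i) μ := by
  have hA : MemLp (fun ω => m.A i ω / (1 + c1)) 2 μ := by
    simpa only [div_eq_inv_mul] using (hm.memLp_A i).const_mul (1 + c1)⁻¹
  have hagg : MemLp (fun ω => m.aSum ω - m.n) 2 μ := hm.memLp_aSum.sub (memLp_const _)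
  have hq : MemLp (fun ω => m.a i ω - m.n / 2 - m.A i ω / (1 + c1)) 2 μ :=
    ((hm.a_sq i).sub (memLp_const _)).sub hA
  have hS : Integrable (m.price μ c1 0) μ := by
    rw [show m.price μ c1 0 = _ from funext (hm.price_zero_eq c1)]
    exact (integrable_const _).add ((((hagg.integrable (by norm_num)).mul_const _).sub
      (integrable_const _)).const_mul _)
  exact (((hS.const_mul _).add (integrable_const _)).add
    (((((hA.integrable (by norm_num)).mul_const _).div_const 2).sub
      (((hagg.integrable (by norm_num)).const_mul _).div_const 4)).mul_const _)).add
    ((((hA.integrable_mul hagg).neg.div_const 2).sub (hq.integrable_sq.div_const 2)).mul_const _)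

omit hlam in
-- Completing the square under the time integral: price impact contributes `c1` and the penalty `1 /
-- 2` to the quadratic coefficient.
lemma payoff_eq (i : Fin 2) {η : ℝ → Ω → ℝ} {ω : Ω}
    (hη : BoundedVariationOn (fun t => η t ω) (Icc 0 m.T)) :
    m.payoff μ lam (m.price μ c1) (m.coeff0 c1) c1 (coeff2 c1) i η ω =
      m.basePayoff μ c1 i ω + m.stochInt μ (fun u ω => η u ω * m.σ u ω) m.T ω -
      (1 + 2 * c1) / 2 * (∫ u in (0 : ℝ)..m.T, m.κ u *
        (η u ω - m.n / 2 - signOf (m.A i ω) * (m.size c1 i ω * m.γ u)) ^ 2) -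
      lam * totalVar (m.n / 2) (fun t => η t ω) m.T := by
  have hP := hm.penalty
  have hb := IsBddMeasOn.of_boundedVariationOn hη
  have hne : 1 + c1 ≠ 0 := by linarith
  have i1 : IntervalIntegrable
      (fun u => η u ω * m.perceivedDrift (m.coeff0 c1) c1 (coeff2 c1) i η u ω) volume 0 m.T := by
    have h0 : IsBddMeasOn m.T fun u => m.coeff0 c1 u (m.aSum ω) :=
      (IsBddMeasOn.const _ _).sub ((hP.γ_bdd.const_mul _).mul (.const _ _))
    have := hP.intervalIntegrable (hb.mul ((h0.sub (hb.const_mul c1)).add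
      ((hP.γ_bdd.mul (.const _ (coeff2 c1))).mul (.const _ (m.a i ω - m.n / 2)))))
      hP.zero_mem hP.T_mem
    refine this.congr fun u _ => ?_
    simp only [perceivedDrift]
    ring
  have i2 := hP.intervalIntegrable ((hP.γ_bdd.mul (.const _ (m.a i ω - m.n / 2))).sub
    (hb.sub (.const _ (m.n / 2)))).sq hP.zero_mem hP.T_mem
  have i3 := hP.intervalIntegrable ((hb.sub (.const _ (m.n / 2))).sub
    ((hP.γ_bdd.const_mul (m.size c1 i ω)).const_mul (signOf (m.A i ω)))).sq hP.zero_mem hP.T_mem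
  have k0 := hP.intervalIntegrable_κ hP.zero_mem hP.T_mem
  have k1 := hP.intervalIntegrable hP.γ_bdd hP.zero_mem hP.T_mem
  have k2 := hP.intervalIntegrable (hP.γ_bdd.mul hP.γ_bdd) hP.zero_mem hP.T_mem
  have key : (∫ u in (0 : ℝ)..m.T,
        η u ω * m.perceivedDrift (m.coeff0 c1) c1 (coeff2 c1) i η u ω) - m.loss i η ω =
      (m.n * (c1 * m.n) / 4) * (∫ u in (0 : ℝ)..m.T, m.κ u) +
      (m.A i ω / (1 + c1) * (c1 * m.n) / 2 - m.n * (m.aSum ω - m.n) / 4) *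
        (∫ u in (0 : ℝ)..m.T, m.κ u * m.γ u) +
      (-(m.A i ω / (1 + c1) * (m.aSum ω - m.n)) / 2 -
        (m.a i ω - m.n / 2 - m.A i ω / (1 + c1)) ^ 2 / 2) *
        (∫ u in (0 : ℝ)..m.T, m.κ u * (m.γ u * m.γ u)) -
      (1 + 2 * c1) / 2 * (∫ u in (0 : ℝ)..m.T, m.κ u *
        (η u ω - m.n / 2 - signOf (m.A i ω) * (m.size c1 i ω * m.γ u)) ^ 2) := by
    rw [loss, ← intervalIntegral.integral_const_mul, ← intervalIntegral.integral_const_mul,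
      ← intervalIntegral.integral_const_mul, ← intervalIntegral.integral_const_mul,
      ← intervalIntegral.integral_const_mul,
      ← intervalIntegral.integral_sub i1 (i2.const_mul _),
      ← intervalIntegral.integral_add (k0.const_mul _) (k1.const_mul _),
      ← intervalIntegral.integral_add ((k0.const_mul _).add (k1.const_mul _)) (k2.const_mul _),
      ← intervalIntegral.integral_sub (((k0.const_mul _).add (k1.const_mul _)).add
        (k2.const_mul _)) (i3.const_mul _)]
    refine intervalIntegral.integral_congr fun u _ => ?_
    have hs : signOf (m.A i ω) * (m.size c1 i ω * m.γ u) = m.A i ω / (1 + c1) * m.γ u := by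
      rw [← mul_assoc, signOf_mul_size]
    simp only [hs]
    simp only [perceivedDrift, coeff0, coeff2, A]
    field_simp
    ring
  rw [payoff, wealth, basePayoff]
  have hTV : upPart (m.n / 2) (fun u => η u ω) m.T + downPart (m.n / 2) (fun u => η u ω) m.T =
      totalVar (m.n / 2) (fun u => η u ω) m.T := by
    rw [upPart, downPart]
    ring
  rw [hTV]
  linarith

lemma totalVar_holdings (i : Fin 2) (ω : Ω) :
    totalVar (m.n / 2) (fun t => m.holdings lam c1 i t ω) m.T =
      plateau m.κ m.γ m.T (lam / (1 + 2 * c1)) (m.size c1 i ω) := by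
  have hℓ := cost_pos hlam hc1
  have hz := size_nonneg (m := m) hc1 i ω
  have hP := hm.penalty
  rw [holdings_fun_eq hlam hc1, totalVar_signed (signOf_sq _) (hP.position_mono hℓ hz)
    (hP.position_nonneg hℓ hz hP.zero_mem) hP.T_mem, hP.position_T hℓ]

lemma payoff_holdings (i : Fin 2) (ω : Ω) :
    m.payoff μ lam (m.price μ c1) (m.coeff0 c1) c1 (coeff2 c1) i (m.holdings lam c1 i) ω =
      m.basePayoff μ c1 i ω +
        m.stochInt μ (fun u ω => m.holdings lam c1 i u ω * m.σ u ω) m.T ω -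
      (1 + 2 * c1) / 2 * ((∫ u in (0 : ℝ)..m.T, m.κ u *
        (signOf (m.A i ω) * position m.κ m.γ m.T (lam / (1 + 2 * c1)) (m.size c1 i ω) u -
          signOf (m.A i ω) * (m.size c1 i ω * m.γ u)) ^ 2) +
        2 * (lam / (1 + 2 * c1)) *
          plateau m.κ m.γ m.T (lam / (1 + 2 * c1)) (m.size c1 i ω)) := by
  have hne : 1 + 2 * c1 ≠ 0 := by linarith
  rw [payoff_eq hm hc1 i (holdings_boundedVariationOn hm hlam hc1 i ω),
    totalVar_holdings hm hlam hc1]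
  simp only [holdings_eq hlam hc1 i _ ω, add_sub_cancel_left]
  have h : (1 + 2 * c1) / 2 * (2 * (lam / (1 + 2 * c1)) *
      plateau m.κ m.γ m.T (lam / (1 + 2 * c1)) (m.size c1 i ω)) =
      lam * plateau m.κ m.γ m.T (lam / (1 + 2 * c1)) (m.size c1 i ω) := by
    generalize plateau m.κ m.γ m.T (lam / (1 + 2 * c1)) (m.size c1 i ω) = v
    field_simp
  rw [mul_add, h]
  ring

/-- This is `position_optimal` applied path by path, scaled by `(1 + 2 * c1) / 2`; the excess on the
right has conditional mean zero. -/
lemma payoff_le (i : Fin 2) {η : ℝ → Ω → ℝ} {ω : Ω}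
    (hη : BoundedVariationOn (fun t => η t ω) (Icc 0 m.T)) :
    m.payoff μ lam (m.price μ c1) (m.coeff0 c1) c1 (coeff2 c1) i η ω ≤
      m.payoff μ lam (m.price μ c1) (m.coeff0 c1) c1 (coeff2 c1) i (m.holdings lam c1 i) ω +
        (m.stochInt μ (fun u ω => η u ω * m.σ u ω) m.T ω -
          m.stochInt μ (fun u ω => m.holdings lam c1 i u ω * m.σ u ω) m.T ω) := by
  have hβ : 0 < 1 + 2 * c1 := by linarith
  rw [payoff_holdings hm hlam hc1, payoff_eq hm hc1 i hη]
  have h := hm.penalty.position_optimal (cost_pos hlam hc1) (size_nonneg (m := m) hc1 i ω)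
    (signOf_sq (m.A i ω)) ((IsBddMeasOn.of_boundedVariationOn hη).sub (.const _ (m.n / 2)))
    fun t ht => abs_sub_le_totalVar hη ht
  have h2 := mul_le_mul_of_nonneg_left h (half_pos hβ).le
  have h3 : (1 + 2 * c1) / 2 * (2 * (lam / (1 + 2 * c1)) *
      totalVar (m.n / 2) (fun t => η t ω) m.T) =
      lam * totalVar (m.n / 2) (fun t => η t ω) m.T := by
    field_simp
  rw [mul_add _ _ (2 * (lam / (1 + 2 * c1)) * totalVar (m.n / 2) (fun t => η t ω) m.T), h3] at h2
  linarith

lemma payoff_le_base (i : Fin 2) {η : ℝ → Ω → ℝ} {ω : Ω}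
    (hη : BoundedVariationOn (fun t => η t ω) (Icc 0 m.T)) :
    m.payoff μ lam (m.price μ c1) (m.coeff0 c1) c1 (coeff2 c1) i η ω ≤
      m.basePayoff μ c1 i ω + m.stochInt μ (fun u ω => η u ω * m.σ u ω) m.T ω := by
  have hP := hm.penalty
  have hb := IsBddMeasOn.of_boundedVariationOn hη
  rw [payoff_eq hm hc1 i hη]
  have h1 := hP.integral_nonneg ((hb.sub (.const _ (m.n / 2))).sub
    ((hP.γ_bdd.const_mul (m.size c1 i ω)).const_mul (signOf (m.A i ω)))).sq hP.zero_mem hP.T_mem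
    hP.T_pos.le fun u _ => sq_nonneg _
  have h2 : 0 ≤ totalVar (m.n / 2) (fun t => η t ω) m.T :=
    (abs_nonneg _).trans (abs_sub_le_totalVar hη hP.zero_mem)
  have h3 := mul_nonneg (by linarith : 0 ≤ (1 + 2 * c1) / 2) h1
  have h4 := mul_nonneg hlam.le h2
  linarith

omit hlam hc1 in
lemma memLp_stochInt [IsProbabilityMeasure μ] (H : ℝ → Ω → ℝ) : MemLp (m.stochInt μ H m.T) 2 μ :=
  memLp_itoIntegral hm.brownianFor hm.T_pos.le

omit hlam hc1 in
lemma integrable_stochInt [IsProbabilityMeasure μ] (H : ℝ → Ω → ℝ) :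
    Integrable (m.stochInt μ H m.T) μ := (memLp_stochInt hm H).integrable (by norm_num)

/-! ### Integrability of the optimal payoff and the equilibrium conditions -/

lemma integrable_payoff_holdings [IsProbabilityMeasure μ] (i : Fin 2) :
    Integrable (m.payoff μ lam (m.price μ c1) (m.coeff0 c1) c1 (coeff2 c1) i
      (m.holdings lam c1 i)) μ := by
  have hP := hm.penalty
  have hℓ := cost_pos hlam hc1
  have hz : ∀ ω, 0 ≤ m.size c1 i ω := fun ω => size_nonneg hc1 i ω
  have hγ0 : ∀ u ∈ Ioo 0 m.T, 0 ≤ m.γ u := fun u hu => (hP.γ_mem u (Ioo_subset_Icc_self hu)).1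
  have hmz : Measurable (m.size c1 i) := (m.measurable_size c1 i).mono hm.targets_le le_rfl
  rw [show m.payoff μ lam (m.price μ c1) (m.coeff0 c1) c1 (coeff2 c1) i (m.holdings lam c1 i) = _
    from funext (payoff_holdings hm hlam hc1 i)]
  refine ((integrable_basePayoff hm i).add (integrable_stochInt hm _)).sub
    (Integrable.const_mul ?_ _)
  refine Integrable.mono' ((memLp_size hm i (c1 := c1)).integrable_sq.mul_const
    (∫ u in (0 : ℝ)..m.T, m.κ u * m.γ u ^ 2)) ?_ (ae_of_all _ fun ω => ?_)
  · simp only [hP.integral_position_sub_sq hℓ (hz _) (signOf_sq _)]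
    have m0 := (hP.measurable_plateau hℓ).comp hmz
    have m1 := (hP.measurable_tail_exitTime hℓ hP.γ_bdd hγ0).comp hmz
    have m2 := (hP.measurable_tail_exitTime hℓ (hP.γ_bdd.mul hP.γ_bdd)
      fun u hu => mul_nonneg (hγ0 u hu) (hγ0 u hu)).comp hmz
    exact (((hmz.mul ((hmz.mul m2).sub (m0.mul m1))).sub (m0.mul_const _)).add
      (m0.const_mul _)).aestronglyMeasurable
  -- Comparison with not trading at all bounds the minimal cost by a multiple of the squared size.
  · have h1 := hP.position_optimal hℓ (hz ω) (signOf_sq (m.A i ω)) (.const m.T 0) (v := 0)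
      (by simp)
    have h2 := hP.integral_nonneg (((hP.position_bdd hℓ (hz ω)).const_mul
      (signOf (m.A i ω))).sub ((hP.γ_bdd.const_mul (m.size c1 i ω)).const_mul
        (signOf (m.A i ω)))).sq hP.zero_mem hP.T_mem hP.T_pos.le fun u _ => sq_nonneg _
    have h3 := mul_nonneg (mul_nonneg zero_le_two hℓ.le) (hP.plateau_nonneg hℓ (hz ω))
    have h4 : ∫ u in (0 : ℝ)..m.T,
        m.κ u * (0 - signOf (m.A i ω) * (m.size c1 i ω * m.γ u)) ^ 2 =
        m.size c1 i ω ^ 2 * ∫ u in (0 : ℝ)..m.T, m.κ u * m.γ u ^ 2 := by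
      rw [← intervalIntegral.integral_const_mul]
      refine intervalIntegral.integral_congr fun u _ => ?_
      linear_combination (m.κ u * (m.size c1 i ω * m.γ u) ^ 2) * signOf_sq (m.A i ω)
    rw [Real.norm_eq_abs, abs_of_nonneg (add_nonneg h2 h3), ← h4]
    linarith

lemma isPriceImpactEquilibrium_holdings [IsProbabilityMeasure μ] :
    m.IsPriceImpactEquilibrium μ lam (m.holdings lam c1) (m.price μ c1) (m.coeff0 c1) c1
      (coeff2 c1) where
  admissible := holdings_admissible hm hlam hc1
  wellDefined i η hη := by
    have h := ((integrable_basePayoff hm i (c1 := c1)).add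
      (integrable_stochInt hm fun u ω => η u ω * m.σ u ω)).2
    refine lt_of_le_of_lt (lintegral_mono_ae ?_) h
    filter_upwards [hη.finiteVar] with ω hω
    exact (ENNReal.ofReal_le_ofReal ((payoff_le_base hm hlam hc1 i hω).trans
      (le_abs_self _))).trans (Real.enorm_eq_ofReal_abs _).ge
  integrable := integrable_payoff_holdings hm hlam hc1
  optimal i := by
    -- The holdings belong to the family, so being the least upper bound reduces to being an upper
    -- bound.
    refine ⟨?_, fun U _ hU => hU _ ⟨_, holdings_admissible hm hlam hc1 i, rfl⟩⟩
    rintro _ ⟨η, hη, rfl⟩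
    have h0 : ∀ H, μ[m.stochInt μ H m.T | m.info (m.price μ c1) i 0] =ᵐ[μ] 0 := fun H =>
      condExp_itoIntegral hm.brownianFor hm.T_pos.le ((hm.info_zero_le c1 i).trans le_sup_left)
    refine condExpE_le_of_le_add (integrable_payoff_holdings hm hlam hc1 i)
      ((integrable_stochInt hm fun u ω => η u ω * m.σ u ω).sub
        (integrable_stochInt hm fun u ω => m.holdings lam c1 i u ω * m.σ u ω)) ?_
      (hη.finiteVar.mono fun ω hω => payoff_le hm hlam hc1 i hω)
    filter_upwards [condExp_sub (integrable_stochInt hm fun u ω => η u ω * m.σ u ω)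
      (integrable_stochInt hm fun u ω => m.holdings lam c1 i u ω * m.σ u ω)
      (m.info (m.price μ c1) i 0), h0 fun u ω => η u ω * m.σ u ω,
      h0 fun u ω => m.holdings lam c1 i u ω * m.σ u ω] with ω h1 h2 h3
    rw [h1, Pi.sub_apply, h2, h3]
    simp
  clearing := ae_of_all _ fun ω _ ht => holdings_clearing hm hlam hc1 ht ω
  ito := hm.isIto_price c1
  terminal := hm.price_terminal c1
  consistent := ae_of_all _ fun ω _ ht =>
    ⟨holdings_consistent hm hlam hc1 ω ht 0, holdings_consistent hm hlam hc1 ω ht 1⟩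

end Market

end PriceImpact

end

theorem theorem1 {Ω : Type*} [MeasurableSpace Ω] (μ : Measure Ω) [IsProbabilityMeasure μ]
    (m : Market Ω) (hm : m.Standing μ) (lam c1 : ℝ) (hlam : 0 < lam) (hc1 : -(1 / 2) < c1) :
    m.IsPriceImpactEquilibrium μ lam (m.holdings lam c1) (m.price μ c1)
      (m.coeff0 c1) c1 (Market.coeff2 c1) ∧
    ((∃ t ∈ Ico 0 m.T, 0 < m.γ t) →
      ∀ t ∈ Icc 0 m.T, m.info (m.price μ c1) 0 t = m.info (m.price μ c1) 1 t) :=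
  ⟨Market.isPriceImpactEquilibrium_holdings hm hlam hc1, fun h _ ht =>
    hm.info_eq c1 ht.1 (hm.integral_γ_pos h).ne'⟩
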